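/- Let $d<n$ be odd positive integers and let $\mathbb{C}P^d\to\mathbb{C}P^n$, $[z]\mapsto[z,0_{n-d}]$, be the canonical embedding, where $\mathbb{C}P^n$ carries the Fubini–Study metric of constant holomorphic sectional curvature $4$. Let $T^\perp\mathbb{C}P^d\to\mathbb{C}P^d$ be its normal bundle, with the induced metric, the orientation given by the complex structure, and the normal connection. Let $\gamma_d=\{([z],v)\mid [z]\in\mathbb{C}P^d,\ v\in[z]\}$ be the tautological line bundle of $\mathbb{C}P^d$ with its canonical Hermitian metric and connection (the orthogonal projection of the flat derivative of $\mathbb{C}^{d+1}$), and for $m\in\mathbb{Z}$ let $\gamma_d^m$ be its $m$-th tensor power (a power of the dual bundle if $m<0$) with the induced metric and connection. Then $T^\perp\mathbb{C}P^d$ has a spin structure, and for every spin structure on it, the associated complex spinor bundle $\Sigma(T^\perp\mathbb{C}P^d)$ (of rank $2^{n-d}$, with its Hermitian metric and the connection induced by the normal connection) admits a unitary and parallel isomorphism $$\Sigma(T^\perp\mathbb{C}P^d)\;\cong\;\bigoplus_{s=0}^{n-d}\binom{n-d}{s}\cdot\gamma_d^{\frac{n-d}{2}-s},$$ where the factor $\binom{n-d}{s}$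 is the multiplicity with which the line bundle $\gamma_d^{\frac{n-d}{2}-s}$ appears in the (orthogonal) sum. -/

import Mathlib

open scoped LinearAlgebra.Projectivization

universe u

noncomputable section

namespace SpinNormal

/-! ### Complex projective space with its Fubini-Study geometry -/

/-- `ℂᵐ` with its canonical Hermitian inner product. -/
abbrev CSp (m : ℕ) : Type := EuclideanSpace ℂ (Fin m)

/-- The complex projective space `ℂPⁿ`, the set of complex lines of `ℂⁿ⁺¹`. -/
abbrev CP (n : ℕ) : Type := ℙ ℂ (CSp (n + 1))

/-- The ambient space of the standard embedding of `ℂPⁿ`: the endomorphisms of `ℂⁿ⁺¹`. -/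
abbrev Op (n : ℕ) : Type := CSp (n + 1) →L[ℂ] CSp (n + 1)

/-- The standard embedding of `ℂPⁿ`, sending a line to the orthogonal projection onto it. It defines
the smooth structure of `ℂPⁿ`; its image is the submanifold of rank one orthogonal projections. -/
def lineProj (n : ℕ) (x : CP n) : Op n := x.submodule.starProjection

/-- `(X, Y) ↦ ½ Re tr (X Y)`, a Euclidean inner product on self-adjoint operators. The metric it
induces on `ℂPⁿ` is the Fubini-Study metric of holomorphic sectional curvature `4`: if `‖z‖ = 1` and
`w, w'` are orthogonal to `z`, the tangent vectors `d_zπ(w) = w z* + z w*`, `d_zπ(w')` have inner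
product `Re ⟪w, w'⟫`. -/
def metric (n : ℕ) (X Y : Op n) : ℝ :=
  (LinearMap.trace ℂ (CSp (n + 1)) ((X * Y : Op n) : CSp (n + 1) →ₗ[ℂ] CSp (n + 1))).re / 2

/-- The tangent space at `x` of a manifold `B` embedded in (or mapped by an immersion to) a vector
space by `e`: the velocity vectors at `x` of the smooth curves of `B` through `x`. -/
def tangentSpan {B W : Type*} [NormedAddCommGroup W] [NormedSpace ℝ W] (e : B → W) (x : B) :
    Submodule ℝ W :=
  Submodule.span ℝ {X | ∃ c : ℝ → B, c 0 = x ∧ ContDiff ℝ (⊤ : ℕ∞) (fun t => e (c t)) ∧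
    HasDerivAt (fun t => e (c t)) X 0}

/-- The linear map `ℂᵈ⁺¹ → ℂⁿ⁺¹`, `z ↦ (z, 0)`. -/
def zeroExtend (d n : ℕ) : CSp (d + 1) →ₗ[ℂ] CSp (n + 1) where
  toFun z := WithLp.toLp 2 fun i => if h : (i : ℕ) < d + 1 then z ⟨i, h⟩ else 0
  map_add' z w := by ext i; by_cases h : (i : ℕ) < d + 1 <;> simp [h, -Order.lt_add_one_iff]
  map_smul' a z := by ext i; by_cases h : (i : ℕ) < d + 1 <;> simp [h, -Order.lt_add_one_iff]

theorem zeroExtend_injective {d n : ℕ} (hdn : d < n) : Function.Injective (zeroExtend d n) := by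
  intro z w h
  ext i
  have hi : (i : ℕ) < n + 1 := by omega
  have := congrArg (fun v : CSp (n + 1) => v ⟨i, hi⟩) h
  simpa only [zeroExtend, LinearMap.coe_mk, AddHom.coe_mk, i.2, dif_pos] using this

/-- The canonical embedding `ℂPᵈ → ℂPⁿ`, `[z] ↦ [z, 0]`. -/
def incl {d n : ℕ} (hdn : d < n) : CP d → CP n :=
  Projectivization.map (zeroExtend d n) (zeroExtend_injective hdn)

/-- The position of a point of the submanifold `ℂPᵈ ⊂ ℂPⁿ` in the ambient space of `ℂPⁿ`. -/
def pos {d n : ℕ} (hdn : d < n) (x : CP d) : Op n := lineProj n (incl hdn x)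

/-- The fibre at `x` of the normal bundle `T⊥ℂPᵈ` of the canonical embedding: the vectors of
`TℂPⁿ` at `x` which are orthogonal to `TℂPᵈ`. -/
def normalSpace {d n : ℕ} (hdn : d < n) (x : CP d) : Submodule ℝ (Op n) where
  carrier := {X | X ∈ tangentSpan (lineProj n) (incl hdn x) ∧
    ∀ Y ∈ tangentSpan (pos hdn) x, metric n X Y = 0}
  add_mem' := by
    rintro X X' ⟨h, h0⟩ ⟨h', h0'⟩
    refine ⟨add_mem h h', fun Y hY => ?_⟩
    have := h0 Y hY
    have := h0' Y hY
    simp only [metric, add_mul, ContinuousLinearMap.toLinearMap_add, map_add, Complex.add_re] at *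
    linarith
  zero_mem' := ⟨zero_mem _, fun Y _ => by simp [metric]⟩
  smul_mem' := by
    rintro a X ⟨h, h0⟩
    refine ⟨Submodule.smul_mem _ a h, fun Y hY => ?_⟩
    have := h0 Y hY
    have e : ((a • X * Y : Op n) : CSp (n + 1) →ₗ[ℂ] CSp (n + 1)) =
        (a : ℂ) • ((X * Y : Op n) : CSp (n + 1) →ₗ[ℂ] CSp (n + 1)) := by
      ext v
      simp
    simp only [metric] at *
    rw [e, map_smul, smul_eq_mul, Complex.re_ofReal_mul, mul_div_assoc, this, mul_zero]

/-- The complex structure of `ℂPⁿ`: at the point with orthogonal projection `p` it sends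
`X = d_zπ(w) = w z* + z w*` to `d_zπ(i w) = i (X p - p X)`. -/
def cplxStr {d n : ℕ} (hdn : d < n) (x : CP d) (X : Op n) : Op n :=
  Complex.I • (X * pos hdn x - pos hdn x * X)

/-- `f : ℝ²ᵏ = ℂᵏ → T⊥ₓℂPᵈ` is an orthonormal frame, that is, a linear isometry onto `T⊥ₓℂPᵈ`. -/
def IsOrthonormalFrame {d n : ℕ} (hdn : d < n) (x : CP d) (f : CSp (n - d) →L[ℝ] Op n) : Prop :=
  (f : CSp (n - d) →ₗ[ℝ] Op n).range = normalSpace hdn x ∧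
    ∀ v w, metric n (f v) (f w) = (inner ℂ v w).re

/-- A unitary frame is an orthonormal frame which is complex linear. -/
def IsUnitaryFrame {d n : ℕ} (hdn : d < n) (x : CP d) (f : CSp (n - d) →L[ℝ] Op n) : Prop :=
  IsOrthonormalFrame hdn x f ∧ ∀ v, f (Complex.I • v) = cplxStr hdn x (f v)

/-- An oriented orthonormal frame: one which differs from a unitary frame by a change of basis of
positive determinant. -/
def IsOrientedFrame {d n : ℕ} (hdn : d < n) (x : CP d) (f : CSp (n - d) →L[ℝ] Op n) : Prop :=
  IsOrthonormalFrame hdn x f ∧ ∃ u, IsUnitaryFrame hdn x u ∧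
    ∃ A : CSp (n - d) →ₗ[ℝ] CSp (n - d), 0 < LinearMap.det A ∧ ∀ v, f v = u (A v)

/-- The bundle `SO(T⊥ℂPᵈ)` of oriented orthonormal frames of the normal bundle. -/
def SOFrame {d n : ℕ} (hdn : d < n) : Type :=
  {F : CP d × (CSp (n - d) →L[ℝ] Op n) // IsOrientedFrame hdn F.1 F.2}

/-- The topology of the frame bundle, as a subspace of (position, frame). -/
instance {d n : ℕ} (hdn : d < n) : TopologicalSpace (SOFrame hdn) :=
  TopologicalSpace.induced
    (fun F => ((pos hdn F.1.1, F.1.2) : Op n × (CSp (n - d) →L[ℝ] Op n))) inferInstance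

/-! ### The spin group, the spinor space and spin structures -/

/-- The quadratic form `v ↦ -|v|²` on `ℝ²ᵏ = ℂᵏ` (so `v · v = -|v|²` in the Clifford algebra). -/
def negNormSq (k : ℕ) : QuadraticForm ℝ (CSp k) :=
  LinearMap.BilinMap.toQuadraticMap (LinearMap.mk₂ ℝ (fun v w : CSp k => -(inner ℂ v w).re)
    (fun v v' w => by rw [inner_add_left, Complex.add_re, neg_add])
    (fun a v w => by
      rw [show a • v = (a : ℂ) • v from rfl, inner_smul_left, Complex.conj_ofReal,
        Complex.re_ofReal_mul, smul_eq_mul, mul_neg])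
    (fun v w w' => by rw [inner_add_right, Complex.add_re, neg_add])
    (fun a v w => by
      rw [show a • w = (a : ℂ) • w from rfl, inner_smul_right, Complex.re_ofReal_mul,
        smul_eq_mul, mul_neg]))

theorem negNormSq_apply (k : ℕ) (v : CSp k) : negNormSq k v = -‖v‖ ^ 2 := by
  have := inner_self_eq_norm_sq (𝕜 := ℂ) v
  simp only [RCLike.re_to_complex] at this
  simp only [negNormSq, LinearMap.BilinMap.toQuadraticMap_apply, LinearMap.mk₂_apply, this]

/-- The real Clifford algebra of `ℝ²ᵏ = ℂᵏ`. -/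
abbrev Cl (k : ℕ) : Type := CliffordAlgebra (negNormSq k)

/-- The group `Spin₂ₖ`. -/
abbrev Spin (k : ℕ) : Type := spinGroup (negNormSq k)

/-- The topology of `Spin₂ₖ`, as a subset of the finite-dimensional real vector space `Cl k`. -/
instance (k : ℕ) : TopologicalSpace (Spin k) :=
  TopologicalSpace.induced Subtype.val (moduleTopology ℝ (Cl k))

/-- The spinor space `Σ₂ₖ = Λ ℂᵏ`, of complex dimension `2ᵏ`, with the Hermitian inner product for
which the vectors `e_S = e_{i₁} ∧ ⋯ ∧ e_{iᵣ}`, `S = {i₁ < ⋯ < iᵣ} ⊆ {1, …, k}`, are orthonormal;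
`ψ S` is the coefficient of `ψ` at `e_S`. -/
abbrev Spinor (k : ℕ) : Type := EuclideanSpace ℂ (Finset (Fin k))

/-- The sign of `e_j ∧ e_{S \ j} = ± e_S`. -/
def wedgeSign {k : ℕ} (j : Fin k) (S : Finset (Fin k)) : ℂ :=
  ∏ i ∈ Finset.Iio j, if i ∈ S then -1 else 1

/-- The matrix coefficient of Clifford multiplication by `w` from `S ∆ {j}` to `S`. -/
def cliffCoeff {k : ℕ} (w : CSp k) (j : Fin k) (S : Finset (Fin k)) : ℂ :=
  wedgeSign j S * if j ∈ S then w j else -(starRingEnd ℂ) (w j)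

/-- Clifford multiplication `w · ψ = w ∧ ψ - w ⌟ ψ` of vectors `w ∈ ℝ²ᵏ = ℂᵏ` on spinors. -/
def cliffMul (k : ℕ) : CSp k →ₗ[ℝ] Module.End ℂ (Spinor k) where
  toFun w :=
    { toFun := fun ψ => WithLp.toLp 2 fun S => ∑ j, cliffCoeff w j S * ψ (symmDiff S {j})
      map_add' := fun ψ φ => by
        ext S
        simp [mul_add, Finset.sum_add_distrib]
      map_smul' := fun a ψ => by
        ext S
        simp [Finset.mul_sum, mul_left_comm] }
  map_add' v w := by
    ext ψ S
    simp only [LinearMap.coe_mk, AddHom.coe_mk, LinearMap.add_apply, PiLp.add_apply,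
      ← Finset.sum_add_distrib]
    refine Finset.sum_congr rfl fun j _ => ?_
    by_cases h : j ∈ S <;> simp [cliffCoeff, h] <;> ring
  map_smul' a w := by
    ext ψ S
    simp only [LinearMap.coe_mk, AddHom.coe_mk, LinearMap.smul_apply, PiLp.smul_apply,
      Finset.smul_sum, RingHom.id_apply]
    refine Finset.sum_congr rfl fun j _ => ?_
    by_cases h : j ∈ S <;> simp [cliffCoeff, h] <;> ring

theorem wedgeSign_symmDiff {k : ℕ} (j l : Fin k) (S : Finset (Fin k)) :
    wedgeSign j (symmDiff S {l}) = if l < j then -wedgeSign j S else wedgeSign j S := by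
  have key : ∀ i : Fin k, (if i ∈ symmDiff S {l} then (-1 : ℂ) else 1) =
      (if i = l then -1 else 1) * (if i ∈ S then -1 else 1) := by
    intro i
    by_cases h : i ∈ S <;> by_cases h' : i = l <;> simp [Finset.mem_symmDiff, h, h']
  simp only [wedgeSign, key, Finset.prod_mul_distrib, Finset.prod_ite_eq', Finset.mem_Iio]
  split_ifs <;> simp

theorem wedgeSign_mul_self {k : ℕ} (j : Fin k) (S : Finset (Fin k)) :
    wedgeSign j S * wedgeSign j S = 1 := by
  simp only [wedgeSign, ← Finset.prod_mul_distrib]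
  refine Finset.prod_eq_one fun i _ => ?_
  split_ifs <;> simp

theorem cliffCoeff_anticomm {k : ℕ} (w : CSp k) (j l : Fin k) (S : Finset (Fin k)) :
    cliffCoeff w j S * cliffCoeff w l (symmDiff S {j}) +
      cliffCoeff w l S * cliffCoeff w j (symmDiff S {l}) =
      if j = l then -2 * (‖w j‖ : ℂ) ^ 2 else 0 := by
  by_cases hjl : j = l
  · subst hjl
    have h1 := wedgeSign_mul_self j S
    have h2 := Complex.mul_conj' (w j)
    by_cases h : j ∈ S <;>
      simp only [cliffCoeff, wedgeSign_symmDiff, lt_irrefl, h, Finset.mem_symmDiff, if_true,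
        if_false, Finset.mem_singleton, not_true_eq_false, and_false, or_false,
        and_true, not_false_eq_true, or_true] <;> linear_combination
        -2 * w j * (starRingEnd ℂ) (w j) * h1 - 2 * h2
  · have hlj : ¬ l = j := fun h => hjl h.symm
    have m1 : j ∈ symmDiff S {l} ↔ j ∈ S := by simp [Finset.mem_symmDiff, hjl]
    have m2 : l ∈ symmDiff S {j} ↔ l ∈ S := by simp [Finset.mem_symmDiff, hlj]
    simp only [cliffCoeff, wedgeSign_symmDiff, m1, m2, hjl, if_false]
    rcases lt_or_gt_of_ne hjl with h | h
    · simp only [h, if_true, not_lt.2 h.le, if_false]; ring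
    · simp only [h, if_true, not_lt.2 h.le, if_false]; ring

theorem cliffMul_mul_self (k : ℕ) (w : CSp k) :
    cliffMul k w * cliffMul k w = algebraMap ℝ (Module.End ℂ (Spinor k)) (negNormSq k w) := by
  ext ψ S
  have hsum : ∀ f : Fin k → Fin k → ℂ, ∑ j, ∑ l, f j l = (∑ j, ∑ l, (f j l + f l j)) / 2 := by
    intro f
    simp only [Finset.sum_add_distrib]
    rw [Finset.sum_comm (f := fun j l => f l j)]
    ring
  have hsym : ∀ j l : Fin k,
      symmDiff (symmDiff S {l}) {j} = symmDiff (symmDiff S {j}) {l} := fun j l => by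
    rw [symmDiff_right_comm]
  have hl : (cliffMul k w * cliffMul k w) ψ S =
      ∑ j, ∑ l, cliffCoeff w j S * (cliffCoeff w l (symmDiff S {j}) *
        ψ (symmDiff (symmDiff S {j}) {l})) := by
    simp [cliffMul, Finset.mul_sum]
  have hr : (algebraMap ℝ (Module.End ℂ (Spinor k)) (negNormSq k w)) ψ S =
      (negNormSq k w : ℂ) * ψ S := by
    simp [Module.algebraMap_end_apply]
  rw [hl, hr, hsum]
  have hterm : ∀ j l : Fin k, cliffCoeff w j S * (cliffCoeff w l (symmDiff S {j}) *
        ψ (symmDiff (symmDiff S {j}) {l})) + cliffCoeff w l S *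
        (cliffCoeff w j (symmDiff S {l}) * ψ (symmDiff (symmDiff S {l}) {j})) =
      if j = l then -2 * (‖w j‖ : ℂ) ^ 2 * ψ S else 0 := by
    intro j l
    rw [hsym j l]
    have h := cliffCoeff_anticomm w j l S
    by_cases hjl : j = l
    · subst hjl
      simp only [if_true] at h ⊢
      rw [symmDiff_assoc, symmDiff_self, symmDiff_bot] at *
      linear_combination ψ S * h
    · simp only [hjl, if_false] at h ⊢
      linear_combination ψ (symmDiff (symmDiff S {j}) {l}) * h
  simp only [hterm, Finset.sum_ite_eq, Finset.mem_univ, if_true]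
  rw [negNormSq_apply, EuclideanSpace.norm_sq_eq, ← Finset.sum_mul, ← Finset.mul_sum]
  push_cast
  ring

/-- The complex spinor representation of the Clifford algebra. It is irreducible, having the
dimension `2ᵏ` of the unique irreducible complex representation of `Cl k`, and vectors of `ℝ²ᵏ`
act by skew-Hermitian operators. -/
def cliffRep (k : ℕ) : Cl k →ₐ[ℝ] Module.End ℂ (Spinor k) :=
  CliffordAlgebra.lift (negNormSq k) ⟨cliffMul k, cliffMul_mul_self k⟩

/-- The spinor representation `δ₂ₖ` of `Spin₂ₖ`. -/
def spinRep (k : ℕ) (g : Spin k) : Spinor k →ₗ[ℂ] Spinor k := cliffRep k g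

/-- A spin structure on the normal bundle `T⊥ℂPᵈ`: a principal `Spin`-bundle `P` over `ℂPᵈ` with an
equivariant (two-sheeted) covering map to the bundle of oriented orthonormal frames. The right
action is simply transitive on the fibres over `ℂPᵈ`. -/
structure SpinStructure {d n : ℕ} (hdn : d < n) where
  /-- the total space -/
  P : Type u
  [top : TopologicalSpace P]
  /-- the right action of the spin group -/
  act : P → Spin (n - d) → P
  /-- the covering of the bundle of oriented orthonormal frames -/
  toFrame : P → SOFrame hdn
  act_one : ∀ p, act p 1 = p
  act_mul : ∀ p g h, act p (g * h) = act (act p g) h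
  continuous_act : Continuous fun q : P × Spin (n - d) => act q.1 q.2
  simply_transitive : ∀ p q, (toFrame p).1.1 = (toFrame q).1.1 → ∃! g, q = act p g
  covering : IsCoveringMap toFrame
  surjective : Function.Surjective toFrame
  base_act : ∀ p g, (toFrame (act p g)).1.1 = (toFrame p).1.1
  /-- `toFrame (p g) = toFrame p ∘ ξ(g)`, where `ξ : Spin → SO` is the double covering
  `ξ(g) v = g v g⁻¹`. -/
  frame_act : ∀ p (g : Spin (n - d)) (v w : CSp (n - d)),
    CliffordAlgebra.ι (negNormSq (n - d)) w =
      (g : Cl (n - d)) * CliffordAlgebra.ι (negNormSq (n - d)) v * ((g⁻¹ : Spin (n - d)) : Cl (n - d)) →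
    (toFrame (act p g)).1.2 v = (toFrame p).1.2 w

attribute [instance] SpinStructure.top

/-! ### Associated vector bundles -/

/-- The fibre at `x` of the vector bundle associated to a principal `G`-bundle `π : P → B` (with
right action `act`) by a representation `ρ` of `G` on `V`. The element `[p, v]` of `P ×_ρ V` is the
function `φ` on the fibre of `P` with `φ p = v` and `φ (p g) = ρ(g)⁻¹ v`. -/
def AssocFibre {B P G V : Type*} [AddCommGroup V] [Module ℂ V] (π : P → B) (act : P → G → P)
    (ρ : G → V →ₗ[ℂ] V) (x : B) : Submodule ℂ ({p : P // π p = x} → V) where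
  carrier := {φ | ∀ (p q : {p : P // π p = x}) (g : G), (q : P) = act p g → φ p = ρ g (φ q)}
  add_mem' := fun {φ ψ} hφ hψ p q g h => by simp [hφ p q g h, hψ p q g h]
  zero_mem' := fun p q g h => by simp
  smul_mem' := fun a φ hφ p q g h => by simp [hφ p q g h]

/-- The covariant derivative of a section `ψ` of an associated bundle along a curve `c` of the base,
at the time `t₀`, is `φ`: in terms of a lift `p` of `c` to the principal bundle which is horizontal
near `t₀`, one has `ψ = [p, σ]` and `φ = [p, σ']`. -/
def HasCovDerivAt {B P G V : Type*} [NormedAddCommGroup V] [NormedSpace ℂ V]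
    {π : P → B} {act : P → G → P} {ρ : G → V →ₗ[ℂ] V} (horizontal : (ℝ → P) → ℝ → Prop)
    (c : ℝ → B) (ψ : ∀ t, AssocFibre π act ρ (c t)) (t₀ : ℝ) (φ : AssocFibre π act ρ (c t₀)) :
    Prop :=
  ∃ p : ∀ t, {p : P // π p = c t}, horizontal (fun t => (p t : P)) t₀ ∧
    HasDerivAt (fun t => (ψ t : _ → V) (p t)) ((φ : _ → V) (p t₀)) t₀

/-! ### The spinor bundle of the normal bundle -/

variable {d n : ℕ} {hdn : d < n}

/-- The projection of the principal spin bundle to `ℂPᵈ`. -/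
def SpinStructure.base (S : SpinStructure hdn) (p : S.P) : CP d := (S.toFrame p).1.1

/-- The curve `p` in the spin bundle is horizontal near the time `t₀` for the connection lifted from
the normal connection of `T⊥ℂPᵈ`: it is continuous, and the frame it covers consists of parallel
normal fields. Here the normal covariant derivative of a normal field along a curve is the
orthogonal projection to the normal space of its derivative: the Levi-Civita connection of `ℂPⁿ` is
the projection to `TℂPⁿ` of the derivative in the ambient Euclidean space. -/
def SpinStructure.IsHorizontalAt (S : SpinStructure hdn) (p : ℝ → S.P) (t₀ : ℝ) : Prop :=
  ∀ᶠ t in nhds t₀, ContinuousAt p t ∧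
    ∃ f' : CSp (n - d) →L[ℝ] Op n, HasDerivAt (fun s => (S.toFrame (p s)).1.2) f' t ∧
      ∀ v, ∀ Y ∈ normalSpace hdn (S.base (p t)), metric n (f' v) Y = 0

/-- The fibre at `x` of the spinor bundle `Σ(T⊥ℂPᵈ)`. -/
abbrev SpinStructure.SpinorFibre (S : SpinStructure hdn) (x : CP d) :
    Submodule ℂ ({p : S.P // S.base p = x} → Spinor (n - d)) :=
  AssocFibre S.base S.act (spinRep (n - d)) x

/-! ### Powers of the tautological bundle -/

/-- The unitary frame bundle of the tautological bundle `γ_d = {([z], v) | v ∈ [z]}` with its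
canonical Hermitian metric: the unit vectors of the lines. -/
def TautFrame (d : ℕ) : Type := {F : CP d × CSp (d + 1) // F.2 ∈ F.1.submodule ∧ ‖F.2‖ = 1}

/-- The projection to `ℂPᵈ`. -/
def TautFrame.base (z : TautFrame d) : CP d := z.1.1

/-- The principal action of `U₁`. -/
def TautFrame.act (z : TautFrame d) (u : Circle) : TautFrame d :=
  ⟨(z.1.1, (u : ℂ) • z.1.2), Submodule.smul_mem _ _ z.2.1, by rw [norm_smul, z.2.2, Circle.norm_coe, mul_one]⟩

/-- The curve `z` of unit vectors of `γ_d` is horizontal near the time `t₀` for the canonical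
connection of `γ_d`: the orthogonal projection of its derivative to `γ_d` vanishes. -/
def TautFrame.IsHorizontalAt (z : ℝ → TautFrame d) (t₀ : ℝ) : Prop :=
  ∀ᶠ t in nhds t₀, ∃ z' : CSp (d + 1), HasDerivAt (fun s => (z s).1.2) z' t ∧
    ∀ w ∈ (z t).base.submodule, inner ℂ w z' = 0

/-- The character `u ↦ uᵐ` of `U₁`. -/
def powRep (m : ℤ) (u : Circle) : ℂ →ₗ[ℂ] ℂ := ((u : ℂ) ^ m) • LinearMap.id

/-- The fibre at `x` of the power `γ_dᵐ`, `m ∈ ℤ`: its elements `h(z) z^{⊗m}` are given by the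
functions `h` on the unit vectors of the line `x` with `h(z) = uᵐ h(u z)` (`z^{⊗-1}` is the dual
basis, so that negative powers are powers of the dual bundle). -/
abbrev TautPow (d : ℕ) (m : ℤ) (x : CP d) : Submodule ℂ ({z : TautFrame d // z.base = x} → ℂ) :=
  AssocFibre TautFrame.base TautFrame.act (powRep m) x

/-- The exponents, with multiplicity, of the sum `⊕_{s=0}^{k} C(k,s) · γ_d^{k/2-s}`. -/
abbrev SumIndex (k : ℕ) : Type := Σ s : Fin (k + 1), Fin (k.choose s)

/-- The exponent `k/2 - s`, an integer for even `k`. -/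
def exponent {k : ℕ} (j : SumIndex k) : ℤ := (k : ℤ) / 2 - ((j.1 : ℕ) : ℤ)

/-- The fibre at `x` of the Hermitian bundle `⊕_{s=0}^{k} C(k,s) · γ_d^{k/2-s}`. -/
abbrev TautSum (d k : ℕ) (x : CP d) : Type := ∀ j : SumIndex k, TautPow d (exponent j) x

/-- A family of fibrewise isomorphisms `Σ(T⊥ℂPᵈ) → ⊕_s C(n-d,s) · γ_d^{(n-d)/2-s}` is unitary. The
inner products of the fibres are computed in arbitrary points of the principal bundles. -/
def IsUnitary (S : SpinStructure hdn) (F : ∀ x, S.SpinorFibre x ≃ₗ[ℂ] TautSum d (n - d) x) : Prop :=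
  ∀ (x : CP d) (φ ψ : S.SpinorFibre x) (p : {p : S.P // S.base p = x})
    (z : {z : TautFrame d // z.base = x}),
    inner ℂ ((φ : _ → Spinor (n - d)) p) ((ψ : _ → Spinor (n - d)) p) =
      ∑ j, inner ℂ ((F x φ j : _ → ℂ) z) ((F x ψ j : _ → ℂ) z)

/-- The family of isomorphisms is parallel: `∇_t (F ψ) = F (∇_t ψ)` for all sections `ψ` along
continuously differentiable curves of `ℂPᵈ`, one side existing if and only if the other does. -/
def IsParallel (S : SpinStructure hdn) (F : ∀ x, S.SpinorFibre x ≃ₗ[ℂ] TautSum d (n - d) x) :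
    Prop :=
  ∀ c : ℝ → CP d, ContDiff ℝ 1 (fun t => lineProj d (c t)) →
    ∀ (ψ : ∀ t, S.SpinorFibre (c t)) (t₀ : ℝ) (φ : S.SpinorFibre (c t₀)),
      HasCovDerivAt S.IsHorizontalAt c ψ t₀ φ ↔
        ∀ j, HasCovDerivAt TautFrame.IsHorizontalAt c (fun t => F (c t) (ψ t) j) t₀ (F (c t₀) φ j)

end SpinNormal

end

/-!
The unit sphere `S²ᵈ⁺¹ ⊂ ℂᵈ⁺¹` is the bundle of unitary frames of `γ_d`, and it also parametrizes
frames of the normal bundle: at the line of the unit vector `z` the normal space consists of the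
operators `(0, w) z* + z (0, w)*`, `w ∈ ℂⁿ⁻ᵈ`, and `w ↦ (0, w) z* + z (0, w)*` is a unitary frame
(`isUnitaryFrame_normalFrame`). It depends linearly on `z`, and replacing `z` by `u z`, `u ∈ U₁`,
replaces the frame by its composition with `u⁻¹` (`normalFrame_smul`). So, as a bundle with
connection, the normal bundle is `Hom(γ_d, ℂⁿ⁻ᵈ)`, a sum of `n - d` copies of the dual of `γ_d`.

Put `k = n - d`, an even number. The homomorphism `u ↦ u⁻¹ id` from `U₁` to the rotation group of
`ℂᵏ` lifts to a homomorphism `λ = circleLift k` to the spin group, and in the spinor representation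
`λ(u)` acts on the coefficient of `e_S` by `u^{k/2 - |S|}` (`spinRep_circleLift`): the coordinate `j`
contributes the square root of `u` or its inverse according to `j ∉ S` or `j ∈ S`.

A spin structure is `S²ᵈ⁺¹ ×_{U₁} Spin₂ₖ`, with `U₁` acting on the spin group through `λ`. Its
projection to the bundle of oriented frames is the quotient by the free action of `{1, -1}`
(`stdSpinStructure`). This uses that the kernel of `Spin → SO` is `{1, -1}`
(`eq_one_or_eq_neg_one`), that `Spin → SO` is onto (`exists_vecProd_of_det_pos`, from the
Cartan-Dieudonné theorem) and that the spin group is compact (`compactSpace_spin`).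

Let now an arbitrary spin structure be given. Since `S²ᵈ⁺¹` has dimension at least `3`, the map from
`S²ᵈ⁺¹` to the frames lifts through the covering (`exists_lift_sphere`), and by the uniqueness of
lifts the lift `j` satisfies `j(u z) = j(z) λ(u)` (`SphereLift.lift_smul`). Hence the spinor with
coefficients `ψ_S` at `j(z)` may be sent to the family of the elements `ψ_S z^{⊗(k/2 - |S|)}`, whatever
unit vector `z` of the line is used (`SphereLift.exists_iso`). This is unitary because the spinor
representation is. It is parallel because `j` maps horizontal curves to horizontal curves
(`SphereLift.isHorizontalAt`), while the horizontal curves over a given curve of `ℂPᵈ` exist in the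
sphere (`Sph.exists_horizontal_lift`) and are unique up to a constant element of the structure
group, both in the sphere (`Sph.IsHorizontalAt.exists_smul_eq`) and in the spin structure
(`SphereLift.exists_act_eq`).
-/

noncomputable section

namespace SpinNormal

section SpinGroup

open CliffordAlgebra

/-! ### The Clifford algebra and the kernel of the double covering -/

theorem inner_real_eq {k : ℕ} (v w : CSp k) : inner ℝ v w = (inner ℂ v w).re := by
  simp [PiLp.inner_apply]

/-- Twisted commutators with vectors are contractions with the polar form. -/
theorem ι_mul_sub_involute_mul_ι {R M : Type*} [CommRing R] [AddCommGroup M] [Module R M]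
    (Q : QuadraticForm R M) (v : M) (x : CliffordAlgebra Q) :
    ι Q v * x - involute x * ι Q v = contractLeft (Q.polarBilin v) x := by
  induction x using CliffordAlgebra.left_induction with
  | algebraMap r =>
    rw [contractLeft_algebraMap, AlgHom.commutes, Algebra.commutes, sub_self]
  | add x y hx hy => rw [map_add, map_add, ← hx, ← hy]; noncomm_ring
  | ι_mul x m hx =>
    rw [contractLeft_ι_mul, ← hx, map_mul, involute_ι]
    have h := ι_mul_ι_add_swap (Q := Q) v m
    have h' : ι Q v * ι Q m = Q.polarBilin v m • (1 : CliffordAlgebra Q) - ι Q m * ι Q v := by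
      rw [eq_sub_iff_add_eq, h, Algebra.algebraMap_eq_smul_one]; rfl
    rw [← mul_assoc, h', sub_mul, smul_mul_assoc, one_mul]
    noncomm_ring

section Exterior

variable {M I : Type*} [AddCommGroup M] [Module ℝ M] [Fintype I]

/-- The Euler operator `∑ᵢ eᵢ ∧ (eᵢ* ⌋ ·)` of the exterior algebra. -/
def euler (b : Module.Basis I ℝ M) : ExteriorAlgebra ℝ M →ₗ[ℝ] ExteriorAlgebra ℝ M :=
  ∑ i, LinearMap.mulLeft ℝ (ι 0 (b i)) ∘ₗ contractLeft (Q := 0) (b.coord i)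

theorem euler_apply (b : Module.Basis I ℝ M) (x : ExteriorAlgebra ℝ M) :
    euler b x = ∑ i, ι 0 (b i) * contractLeft (Q := 0) (b.coord i) x := by
  simp [euler, LinearMap.sum_apply]

theorem euler_ι_mul (b : Module.Basis I ℝ M) (a : M) (x : ExteriorAlgebra ℝ M) :
    euler b (ι 0 a * x) = ι 0 a * x + ι 0 a * euler b x := by
  have hanti : ∀ i, ι (0 : QuadraticForm ℝ M) (b i) * ι 0 a = - (ι 0 a * ι 0 (b i)) := fun i => by
    rw [eq_neg_iff_add_eq_zero, ι_mul_ι_add_swap]; simp [QuadraticMap.polar]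
  have hsum : ∑ i, b.coord i a • ι (0 : QuadraticForm ℝ M) (b i) = ι 0 a := by
    conv_rhs => rw [← b.sum_repr a, map_sum]
    simp
  have hterm : ∀ i, ι (0 : QuadraticForm ℝ M) (b i) * contractLeft (Q := 0) (b.coord i) (ι 0 a * x)
      = (b.coord i a • ι 0 (b i)) * x + ι 0 a * (ι 0 (b i) * contractLeft (b.coord i) x) :=
    fun i => by
      rw [contractLeft_ι_mul, mul_sub, ← mul_assoc, hanti, mul_smul_comm, smul_mul_assoc]
      noncomm_ring
  rw [euler_apply, euler_apply, Finset.sum_congr rfl fun i _ => hterm i, Finset.sum_add_distrib,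
    ← Finset.sum_mul, hsum, Finset.mul_sum]

theorem euler_ιMulti (b : Module.Basis I ℝ M) (r : ℕ) (v : Fin r → M) :
    euler b (ExteriorAlgebra.ιMulti ℝ r v) = (r : ℝ) • ExteriorAlgebra.ιMulti ℝ r v := by
  induction r with
  | zero => simp [euler_apply, ExteriorAlgebra.ιMulti_apply]
  | succ r ih =>
    rw [ExteriorAlgebra.ιMulti_succ_apply]
    have h := euler_ι_mul b (v 0) (ExteriorAlgebra.ιMulti ℝ r (Matrix.vecTail v))
    rw [ih] at h
    refine h.trans ?_
    rw [mul_smul_comm, Nat.cast_succ, add_smul, one_smul, add_comm]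

/-- An element of the exterior algebra which is annihilated by all contractions is a scalar: it is
annihilated by the Euler operator, which multiplies the elements of degree `r` by `r`. -/
theorem exists_eq_algebraMap_of_contractLeft_eq_zero [LinearOrder I] (b : Module.Basis I ℝ M)
    (x : ExteriorAlgebra ℝ M) (hx : ∀ d, contractLeft (Q := 0) d x = 0) :
    ∃ r, x = algebraMap ℝ _ r := by
  have h0 : euler b x = 0 := by simp [euler_apply, hx]
  have hb : ∀ s, euler b (b.ExteriorAlgebra s) = (s.card : ℝ) • b.ExteriorAlgebra s := fun s => by
    rw [ExteriorAlgebra.basis_apply_ofCard b rfl, ExteriorAlgebra.ιMulti_family, euler_ιMulti]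
  have hx' := b.ExteriorAlgebra.sum_repr x
  have h1 : ∑ s, (b.ExteriorAlgebra.repr x s * s.card) • b.ExteriorAlgebra s = 0 := by
    rw [← hx', map_sum] at h0
    simpa only [map_smul, hb, smul_smul] using h0
  have h2 := Fintype.linearIndependent_iff.1 b.ExteriorAlgebra.linearIndependent _ h1
  refine ⟨b.ExteriorAlgebra.repr x ∅, ?_⟩
  conv_lhs => rw [← hx']
  rw [Finset.sum_eq_single ∅, ExteriorAlgebra.basis_apply_ofCard b Finset.card_empty,
    ExteriorAlgebra.ιMulti_family, Algebra.algebraMap_eq_smul_one]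
  · simp [ExteriorAlgebra.ιMulti_apply]
  · intro s _ hs
    have := h2 s
    have hc : (s.card : ℝ) ≠ 0 := by simpa using hs
    rw [(mul_eq_zero.1 this).resolve_right hc, zero_smul]
  · simp

end Exterior

/-- A basis of the real vector space `ℂᵏ`, indexed by a linearly ordered type. -/
def realBasis (k : ℕ) : Module.Basis (Fin (Module.finrank ℝ (CSp k))) ℝ (CSp k) :=
  Module.finBasis ℝ (CSp k)

instance finite_cl (k : ℕ) : Module.Finite ℝ (Cl k) :=
  have := Module.Finite.of_basis (realBasis k).ExteriorAlgebra
  Module.Finite.equiv (equivExterior (negNormSq k)).symm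

theorem polar_negNormSq {k : ℕ} (v w : CSp k) :
    QuadraticMap.polar (negNormSq k) v w = -2 * inner ℝ v w := by
  have := norm_add_sq_real v w
  simp only [QuadraticMap.polar, negNormSq_apply]
  linarith

theorem ι_mul_ι_add {k : ℕ} (v w : CSp k) :
    ι (negNormSq k) v * ι (negNormSq k) w + ι (negNormSq k) w * ι (negNormSq k) v =
      algebraMap ℝ _ (-2 * inner ℝ v w) := by
  rw [ι_mul_ι_add_swap, polar_negNormSq]

theorem ι_sq_unit {k : ℕ} {v : CSp k} (hv : ‖v‖ = 1) :
    ι (negNormSq k) v * ι (negNormSq k) v = -1 := by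
  rw [ι_sq_scalar, negNormSq_apply, hv]; simp

/-- The even elements of the Clifford algebra which commute with all vectors are the scalars: by
`ι_mul_sub_involute_mul_ι` they are annihilated by all contractions, also when they are regarded as
elements of the exterior algebra. -/
theorem exists_eq_algebraMap_of_commute {k : ℕ} {x : Cl k} (hx : involute x = x)
    (hc : ∀ v, ι (negNormSq k) v * x = x * ι (negNormSq k) v) : ∃ r, x = algebraMap ℝ _ r := by
  have h1 : ∀ v, contractLeft ((negNormSq k).polarBilin v) x = 0 := fun v => by
    rw [← ι_mul_sub_involute_mul_ι, hx, hc, sub_self]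
  have h2 : ∀ d : Module.Dual ℝ (CSp k), contractLeft d x = 0 := fun d => by
    have : d = (negNormSq k).polarBilin
        ((-1 / 2 : ℝ) • (InnerProductSpace.toDual ℝ (CSp k)).symm (LinearMap.toContinuousLinearMap d)) := by
      ext w
      rw [QuadraticMap.polarBilin_apply_apply, polar_negNormSq, real_inner_smul_left,
        InnerProductSpace.toDual_symm_apply, LinearMap.coe_toContinuousLinearMap']
      ring
    rw [this, h1]
  obtain ⟨r, hr⟩ := exists_eq_algebraMap_of_contractLeft_eq_zero (realBasis k)
    (equivExterior (negNormSq k) x) (fun d => by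
      have := changeForm_contractLeft (changeForm.associated_neg_proof (Q := negNormSq k)) d x
      rw [h2, map_zero] at this
      exact this.symm)
  have h3 : equivExterior (negNormSq k) (algebraMap ℝ _ r) = algebraMap ℝ _ r :=
    changeForm_algebraMap changeForm.associated_neg_proof r
  exact ⟨r, (equivExterior (negNormSq k)).injective (hr.trans h3.symm)⟩

/-- The kernel of the double covering of the rotation group is `{1, -1}`. -/
theorem eq_one_or_eq_neg_one {k : ℕ} (g : Spin k)
    (hc : ∀ v, ι (negNormSq k) v * (g : Cl k) = g * ι (negNormSq k) v) :
    (g : Cl k) = 1 ∨ (g : Cl k) = -1 := by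
  obtain ⟨r, hr⟩ := exists_eq_algebraMap_of_commute (spinGroup.involute_eq g.2) hc
  have h := spinGroup.coe_star_mul_self g
  rw [hr, CliffordAlgebra.star_algebraMap, ← map_mul, ← map_one (algebraMap ℝ (Cl k))] at h
  have := (algebraMap ℝ (Cl k)).injective h
  rcases mul_self_eq_one_iff.1 this with h | h
  · left; rw [hr, h, map_one]
  · right; rw [hr, h, map_neg, map_one]

/-! ### The double covering of the rotation group -/

/-- The vector part of an element of the Clifford algebra, a linear left inverse of `ι`. -/
def vecPart (k : ℕ) : Cl k →ₗ[ℝ] CSp k :=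
  ExteriorAlgebra.ιInv ∘ₗ (equivExterior (negNormSq k)).toLinearMap

theorem vecPart_ι {k : ℕ} (v : CSp k) : vecPart k (ι (negNormSq k) v) = v := by
  have : equivExterior (negNormSq k) (ι (negNormSq k) v) = ExteriorAlgebra.ι ℝ v :=
    changeForm_ι changeForm.associated_neg_proof v
  rw [vecPart, LinearMap.comp_apply, LinearEquiv.coe_coe, this]
  exact ExteriorAlgebra.ι_leftInverse v

theorem ι_injective (k : ℕ) : Function.Injective (ι (negNormSq k)) :=
  Function.LeftInverse.injective vecPart_ι

/-- The double covering `ξ : Spin → SO`, `ξ(g) v = g v g⁻¹`. -/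
def rot {k : ℕ} (g : Spin k) : CSp k →ₗ[ℝ] CSp k :=
  vecPart k ∘ₗ LinearMap.mulRight ℝ (star (g : Cl k)) ∘ₗ LinearMap.mulLeft ℝ (g : Cl k) ∘ₗ
    ι (negNormSq k)

theorem rot_apply {k : ℕ} (g : Spin k) (v : CSp k) :
    rot g v = vecPart k (g * ι (negNormSq k) v * star (g : Cl k)) := rfl

theorem ι_rot {k : ℕ} (g : Spin k) (v : CSp k) :
    ι (negNormSq k) (rot g v) = g * ι (negNormSq k) v * star (g : Cl k) := by
  obtain ⟨w, hw⟩ := spinGroup.conjAct_smul_ι_mem_range_ι (x := spinGroup.toUnits g) g.2 v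
  have : g * ι (negNormSq k) v * star (g : Cl k) = ι (negNormSq k) w := hw.symm
  rw [rot_apply, this, vecPart_ι]

theorem ι_rot_mul {k : ℕ} (g : Spin k) (v : CSp k) :
    ι (negNormSq k) (rot g v) * g = g * ι (negNormSq k) v := by
  rw [ι_rot, mul_assoc, spinGroup.coe_star_mul_self, mul_one]

theorem rot_eq_of_mul_eq {k : ℕ} {g : Spin k} {v w : CSp k}
    (h : g * ι (negNormSq k) v = ι (negNormSq k) w * g) : rot g v = w := by
  rw [rot_apply, h, mul_assoc, spinGroup.mul_star_self_of_mem g.2, mul_one, vecPart_ι]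

theorem rot_one {k : ℕ} (v : CSp k) : rot (1 : Spin k) v = v :=
  rot_eq_of_mul_eq (by simp)

theorem rot_mul {k : ℕ} (g h : Spin k) (v : CSp k) : rot (g * h) v = rot g (rot h v) :=
  rot_eq_of_mul_eq (by
    rw [Submonoid.coe_mul, mul_assoc, ← ι_rot_mul h, ← mul_assoc, ← ι_rot_mul g, mul_assoc])

theorem norm_rot {k : ℕ} (g : Spin k) (v : CSp k) : ‖rot g v‖ = ‖v‖ := by
  have h : ι (negNormSq k) (rot g v) * ι (negNormSq k) (rot g v) =
      algebraMap ℝ _ (negNormSq k v) := by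
    conv_lhs => rw [ι_rot g, mul_assoc, ← mul_assoc (star _), ← mul_assoc (star _),
      spinGroup.coe_star_mul_self, one_mul, ← mul_assoc, mul_assoc (g : Cl k), ι_sq_scalar,
      ← Algebra.commutes, mul_assoc, spinGroup.mul_star_self_of_mem g.2, mul_one]
  rw [ι_sq_scalar] at h
  have := (algebraMap ℝ (Cl k)).injective h
  rw [negNormSq_apply, negNormSq_apply, neg_inj] at this
  exact (sq_eq_sq₀ (norm_nonneg _) (norm_nonneg _)).1 this

/-- `ξ(g)` as a linear isometry. -/
def rotIso {k : ℕ} (g : Spin k) : CSp k ≃ₗᵢ[ℝ] CSp k where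
  toLinearEquiv := LinearEquiv.ofLinearMap (rot g) (rot g⁻¹)
    (by ext1 v; simp [← rot_mul, rot_one]) (by ext1 v; simp [← rot_mul, rot_one])
  norm_map' := norm_rot g

theorem inner_rot {k : ℕ} (g : Spin k) (v w : CSp k) :
    inner ℝ (rot g v) (rot g w) = inner ℝ v w := (rotIso g).inner_map_map v w

theorem eq_or_eq_neg_of_rot_eq {k : ℕ} {g h : Spin k} (hgh : ∀ v, rot g v = rot h v) :
    (g : Cl k) = h ∨ (g : Cl k) = -h := by
  have h1 : ∀ v, rot (h⁻¹ * g) v = v := fun v => by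
    rw [rot_mul, hgh, ← rot_mul, inv_mul_cancel, rot_one]
  have h2 := eq_one_or_eq_neg_one (h⁻¹ * g) fun v => by
    conv_lhs => rw [← h1 v]
    exact ι_rot_mul _ v
  have h3 : (g : Cl k) = h * ((h⁻¹ * g : Spin k) : Cl k) := by
    rw [← Submonoid.coe_mul, mul_inv_cancel_left]
  rcases h2 with h2 | h2
  · left; rw [h3, h2, mul_one]
  · right; rw [h3, h2, mul_neg, mul_one]

/-- Conjugation by the vector `a` is the reflection in the line of `a`, which fixes `a` and is `-1` on
the orthogonal complement. -/
theorem ι_mul_ι_reflection {k : ℕ} {a : CSp k} (ha : a ≠ 0) (v : CSp k) :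
    ι (negNormSq k) a * ι (negNormSq k) v =
      ι (negNormSq k) ((ℝ ∙ a).reflection v) * ι (negNormSq k) a := by
  have ha' : ‖a‖ ^ 2 ≠ 0 := by simpa using ha
  have h := ι_mul_ι_add a v
  rw [Submodule.reflection_singleton_apply, map_sub, map_nsmul, map_smul, sub_mul, smul_mul_assoc,
    smul_mul_assoc, ι_sq_scalar, negNormSq_apply, eq_sub_iff_add_eq, h,
    Algebra.algebraMap_eq_smul_one, Algebra.algebraMap_eq_smul_one, smul_smul, ← Nat.cast_smul_eq_nsmul ℝ,
    smul_smul]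
  congr 1
  simp only [RCLike.ofReal_real_eq_id, id]
  push_cast
  field_simp

theorem finrank_csp (k : ℕ) : Module.finrank ℝ (CSp k) = 2 * k := by
  have h := Module.finrank_mul_finrank ℝ ℂ (CSp k)
  rw [Complex.finrank_real_complex, finrank_euclideanSpace_fin] at h
  exact h.symm

theorem det_reflection_singleton {k : ℕ} {a : CSp k} (ha : a ≠ 0) :
    LinearMap.det (ℝ ∙ a).reflection.toLinearMap = -1 := by
  have h1 := (ℝ ∙ a).finrank_add_finrank_orthogonal
  rw [finrank_span_singleton ha, finrank_csp] at h1
  rw [Submodule.det_reflection]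
  exact Odd.neg_one_pow ⟨k - 1, by omega⟩

/-- The conjugations by elements of the Lipschitz group are orientation preserving precisely for
the even elements: reflections in lines reverse the orientation, as the dimension is even. -/
theorem lipschitz_parity {k : ℕ} {x : (Cl k)ˣ} (hx : x ∈ lipschitzGroup (negNormSq k)) :
    ∃ A : CSp k →ₗ[ℝ] CSp k, (∀ v, (x : Cl k) * ι (negNormSq k) v = ι (negNormSq k) (A v) * x) ∧
      ((involute (x : Cl k) = x ∧ 0 < LinearMap.det A) ∨
        (involute (x : Cl k) = -x ∧ LinearMap.det A < 0)) := by
  induction hx using Subgroup.closure_induction with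
  | mem x hx =>
    obtain ⟨a, ha⟩ := hx
    have ha0 : a ≠ 0 := by
      rintro rfl
      rw [map_zero] at ha
      exact x.ne_zero ha.symm
    refine ⟨(ℝ ∙ a).reflection.toLinearMap, fun v => ?_, Or.inr ⟨?_, ?_⟩⟩
    · rw [← ha]; exact ι_mul_ι_reflection ha0 v
    · rw [← ha, involute_ι]
    · rw [det_reflection_singleton ha0]; norm_num
  | one => exact ⟨LinearMap.id, by simp, Or.inl (by simp)⟩
  | mul x y _ _ hx hy =>
    obtain ⟨A, hA, hA'⟩ := hx
    obtain ⟨B, hB, hB'⟩ := hy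
    refine ⟨A ∘ₗ B, fun v => ?_, ?_⟩
    · rw [Units.val_mul, mul_assoc, hB, ← mul_assoc, hA, mul_assoc, LinearMap.comp_apply]
    · rw [LinearMap.det_comp, Units.val_mul, map_mul]
      rcases hA' with ⟨h1, h2⟩ | ⟨h1, h2⟩ <;> rcases hB' with ⟨h3, h4⟩ | ⟨h3, h4⟩ <;> rw [h1, h3]
      · exact Or.inl ⟨rfl, mul_pos h2 h4⟩
      · exact Or.inr ⟨mul_neg _ _, mul_neg_of_pos_of_neg h2 h4⟩
      · exact Or.inr ⟨neg_mul _ _, mul_neg_of_neg_of_pos h2 h4⟩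
      · exact Or.inl ⟨neg_mul_neg _ _, mul_pos_of_neg_of_neg h2 h4⟩
  | inv x _ hx =>
    obtain ⟨A, hA, hA'⟩ := hx
    have hdet : LinearMap.det A ≠ 0 := by
      rcases hA' with ⟨_, h⟩ | ⟨_, h⟩
      exacts [h.ne', h.ne]
    let e := LinearEquiv.ofIsUnitDet (v := Module.finBasis ℝ (CSp k)) (v' := Module.finBasis ℝ (CSp k))
      (f := A) (by rw [LinearMap.det_toMatrix]; exact hdet.isUnit)
    have he : ∀ v, A (e.symm v) = v := e.apply_symm_apply
    have hd : LinearMap.det A * LinearMap.det e.symm.toLinearMap = 1 := by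
      rw [← LinearMap.det_comp, ← LinearMap.det_id (A := ℝ) (M := CSp k)]
      congr 1
      ext1 v
      exact he v
    have hinv : involute ((x⁻¹ : (Cl k)ˣ) : Cl k) * involute (x : Cl k) = 1 := by
      rw [← map_mul, Units.inv_mul, map_one]
    refine ⟨e.symm.toLinearMap, fun v => ?_, ?_⟩
    · rw [Units.inv_mul_eq_iff_eq_mul, ← mul_assoc, LinearEquiv.coe_coe, hA, he, Units.mul_inv_cancel_right]
    · rcases hA' with ⟨h1, h2⟩ | ⟨h1, h2⟩ <;> rw [h1] at hinv
      · exact Or.inl ⟨Units.eq_inv_of_mul_eq_one_right hinv, by_contra fun h => by nlinarith⟩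
      · refine Or.inr ⟨?_, by_contra fun h => by nlinarith⟩
        rw [mul_neg, ← neg_mul] at hinv
        exact neg_eq_iff_eq_neg.1 (Units.eq_inv_of_mul_eq_one_right hinv)

theorem det_rot_pos {k : ℕ} (g : Spin k) : 0 < LinearMap.det (rot g) := by
  obtain ⟨A, hA, h⟩ := lipschitz_parity (spinGroup.units_mem_lipschitzGroup
    (x := spinGroup.toUnits g) g.2)
  have hA' : rot g = A := by
    ext1 v
    exact rot_eq_of_mul_eq (hA v)
  rw [hA']
  rcases h with ⟨_, h⟩ | ⟨h1, _⟩
  · exact h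
  · have h2 : involute (g : Cl k) = -g := h1
    rw [spinGroup.involute_eq g.2, eq_neg_iff_add_eq_zero, ← two_smul ℝ] at h2
    exact absurd ((smul_eq_zero_iff_right two_ne_zero).1 h2) (spinGroup.toUnits g).ne_zero

/-! ### Products of unit vectors and compactness of the spin group -/

theorem ι_mem_pinGroup {k : ℕ} {v : CSp k} (hv : ‖v‖ = 1) :
    ι (negNormSq k) v ∈ pinGroup (negNormSq k) := by
  have h := ι_sq_unit hv
  have h1 : ι (negNormSq k) v * -ι (negNormSq k) v = 1 := by rw [mul_neg, h, neg_neg]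
  have h2 : -ι (negNormSq k) v * ι (negNormSq k) v = 1 := by rw [neg_mul, h, neg_neg]
  refine ⟨⟨⟨_, _, h1, h2⟩, Subgroup.subset_closure ⟨v, rfl⟩, rfl⟩, ?_, ?_⟩
  · rw [star_ι, h2]
  · rw [star_ι, h1]

theorem mul_ι_mem_spinGroup {k : ℕ} {v w : CSp k} (hv : ‖v‖ = 1) (hw : ‖w‖ = 1) :
    ι (negNormSq k) v * ι (negNormSq k) w ∈ spinGroup (negNormSq k) :=
  ⟨mul_mem (ι_mem_pinGroup hv) (ι_mem_pinGroup hw), ι_mul_ι_mem_evenOdd_zero _ v w⟩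

/-- The product in the Clifford algebra of a list of vectors. -/
def vecProd {k : ℕ} (l : List (CSp k)) : Cl k := (l.map (ι (negNormSq k))).prod

theorem vecProd_cons {k : ℕ} (v : CSp k) (l : List (CSp k)) :
    vecProd (v :: l) = ι (negNormSq k) v * vecProd l := by
  rw [vecProd, List.map_cons, List.prod_cons]; rfl

theorem vecProd_mem_pinGroup {k : ℕ} {l : List (CSp k)} (hl : ∀ v ∈ l, ‖v‖ = 1) :
    vecProd l ∈ pinGroup (negNormSq k) := by
  refine Submonoid.list_prod_mem _ fun x hx => ?_
  obtain ⟨v, hv, rfl⟩ := List.mem_map.1 hx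
  exact ι_mem_pinGroup (hl v hv)

theorem vecProd_mem_spinGroup {k : ℕ} {l : List (CSp k)} (hl : ∀ v ∈ l, ‖v‖ = 1)
    (he : Even l.length) : vecProd l ∈ spinGroup (negNormSq k) := by
  refine ⟨vecProd_mem_pinGroup hl, ?_⟩
  have : ∀ l : List (CSp k), vecProd l ∈ evenOdd (negNormSq k) (l.length : ZMod 2) := fun l => by
    induction l with
    | nil => exact Submodule.one_le.1 (one_le_evenOdd_zero _)
    | cons v l ih =>
      rw [vecProd_cons, List.length_cons, Nat.cast_succ, add_comm]
      exact evenOdd_mul_le _ _ _ (Submodule.mul_mem_mul (ι_mem_evenOdd_one _ v) ih)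
  have h := this l
  rwa [(ZMod.natCast_eq_zero_iff_even).2 he] at h

theorem vecProd_mul_ι {k : ℕ} {l : List (CSp k)} (hl : ∀ v ∈ l, ‖v‖ = 1) (w : CSp k) :
    vecProd l * ι (negNormSq k) w = ι (negNormSq k)
      ((-1 : ℝ) ^ l.length • (l.map fun v => (ℝ ∙ v)ᗮ.reflection).prod w) * vecProd l := by
  induction l with
  | nil => simp [vecProd]
  | cons v l ih =>
    have hv : v ≠ 0 := by
      rintro rfl
      simpa using hl 0
    rw [vecProd_cons, mul_assoc, ih (fun v hv => hl v (List.mem_cons_of_mem _ hv)), ← mul_assoc,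
      ι_mul_ι_reflection hv, ← mul_assoc, List.map_cons, List.prod_cons, List.length_cons, pow_succ]
    congr 3
    change _ = _ • (ℝ ∙ v)ᗮ.reflection _
    rw [Submodule.reflection_orthogonal_apply, map_smul, mul_neg_one, neg_smul, smul_neg, neg_neg]
    rfl

/-- The **Cartan-Dieudonné theorem** with unit vectors. -/
theorem exists_unit_reflections {k : ℕ} (φ : CSp k ≃ₗᵢ[ℝ] CSp k) :
    ∃ l : List (CSp k), (∀ v ∈ l, ‖v‖ = 1) ∧ l.length ≤ 2 * k ∧
      φ = (l.map fun v => (ℝ ∙ v)ᗮ.reflection).prod := by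
  obtain ⟨l, hl, rfl⟩ := φ.reflections_generate_dim
  rw [finrank_csp] at hl
  suffices ∃ l' : List (CSp k), (∀ v ∈ l', ‖v‖ = 1) ∧ l'.length ≤ l.length ∧
      (l.map fun v => (ℝ ∙ v)ᗮ.reflection).prod = (l'.map fun v => (ℝ ∙ v)ᗮ.reflection).prod by
    obtain ⟨l', h1, h2, h3⟩ := this
    exact ⟨l', h1, h2.trans hl, h3⟩
  clear hl
  induction l with
  | nil => exact ⟨[], by simp⟩
  | cons v l ih =>
    obtain ⟨l', h1, h2, h3⟩ := ih
    by_cases hv : v = 0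
    · refine ⟨l', h1, h2.trans (Nat.le_succ _), ?_⟩
      have h4 : (ℝ ∙ (0 : CSp k))ᗮ.reflection = 1 := by
        ext1 w
        exact Submodule.reflection_mem_subspace_eq_self (by simp)
      rw [List.map_cons, List.prod_cons, h3, hv, h4, one_mul]
    · refine ⟨(‖v‖⁻¹ • v) :: l', ?_, Nat.succ_le_succ h2, ?_⟩
      · intro w hw
        rcases List.mem_cons.1 hw with rfl | hw
        · rw [norm_smul, norm_inv, norm_norm, inv_mul_cancel₀ (norm_ne_zero_iff.2 hv)]
        · exact h1 w hw
      · have : (ℝ ∙ (‖v‖⁻¹ • v)) = ℝ ∙ v :=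
          Submodule.span_singleton_smul_eq (IsUnit.mk0 _ (inv_ne_zero (norm_ne_zero_iff.2 hv))) v
        rw [List.map_cons, List.prod_cons, List.map_cons, List.prod_cons, h3]
        simp only [this]

theorem det_reflections {k : ℕ} {l : List (CSp k)} (hl : ∀ v ∈ l, ‖v‖ = 1) :
    LinearMap.det (l.map fun v => (ℝ ∙ v)ᗮ.reflection).prod.toLinearMap = (-1) ^ l.length := by
  induction l with
  | nil => exact LinearMap.det_id
  | cons v l ih =>
    have hv : v ≠ 0 := by
      rintro rfl
      simpa using hl 0
    have h1 : LinearMap.det ((ℝ ∙ v)ᗮ.reflection).toLinearMap = -1 := by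
      rw [Submodule.det_reflection, Submodule.orthogonal_orthogonal, finrank_span_singleton hv, pow_one]
    rw [List.length_cons, pow_succ', ← ih fun v hv => hl v (List.mem_cons_of_mem _ hv), ← h1,
      ← LinearMap.det_comp]
    rfl

/-- Every rotation is covered by an even product of at most `2k` unit vectors. -/
theorem exists_vecProd_of_det_pos {k : ℕ} (φ : CSp k ≃ₗᵢ[ℝ] CSp k)
    (hφ : 0 < LinearMap.det φ.toLinearMap) :
    ∃ l : List (CSp k), (∀ v ∈ l, ‖v‖ = 1) ∧ l.length ≤ 2 * k ∧ Even l.length ∧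
      ∃ g : Spin k, (g : Cl k) = vecProd l ∧ ∀ v, rot g v = φ v := by
  obtain ⟨l, h1, h2, rfl⟩ := exists_unit_reflections φ
  rw [det_reflections h1] at hφ
  have he : Even l.length := by
    by_contra h
    rw [(Nat.not_even_iff_odd.1 h).neg_one_pow] at hφ
    norm_num at hφ
  refine ⟨l, h1, h2, he, ⟨vecProd l, vecProd_mem_spinGroup h1 he⟩, rfl, fun v => rot_eq_of_mul_eq ?_⟩
  have := vecProd_mul_ι h1 v
  rwa [he.neg_one_pow, one_smul] at this

/-- Up to sign, the elements of the spin group are products of a bounded number of unit vectors. -/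
theorem exists_vecProd_eq {k : ℕ} (g : Spin k) :
    ∃ l : List (CSp k), (∀ v ∈ l, ‖v‖ = 1) ∧ l.length ≤ 2 * k ∧ Even l.length ∧
      ((g : Cl k) = vecProd l ∨ (g : Cl k) = -vecProd l) := by
  obtain ⟨l, h1, h2, h3, g', hg, h4⟩ := exists_vecProd_of_det_pos (rotIso g) (det_rot_pos g)
  refine ⟨l, h1, h2, h3, ?_⟩
  rw [← hg]
  exact eq_or_eq_neg_of_rot_eq fun v => (h4 v).symm

/-- The topology of `Cl k` as a finite-dimensional real vector space. -/
instance clTopology (k : ℕ) : TopologicalSpace (Cl k) := moduleTopology ℝ (Cl k)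

instance clIsModuleTopology (k : ℕ) : IsModuleTopology ℝ (Cl k) := ⟨rfl⟩

instance clIsTopologicalRing (k : ℕ) : IsTopologicalRing (Cl k) :=
  IsModuleTopology.isTopologicalRing ℝ (Cl k)

instance clContinuousSMul (k : ℕ) : ContinuousSMul ℝ (Cl k) :=
  IsModuleTopology.toContinuousSMul ℝ (Cl k)

instance clT2Space (k : ℕ) : T2Space (Cl k) :=
  let e := (Module.finBasis ℝ (Cl k)).equivFun
  T2Space.of_injective_continuous e.injective (IsModuleTopology.continuous_of_linearMap e.toLinearMap)

theorem continuous_ι (k : ℕ) : Continuous (ι (negNormSq k)) :=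
  LinearMap.continuous_of_finiteDimensional _

theorem continuous_spin_val (k : ℕ) : Continuous (Subtype.val : Spin k → Cl k) :=
  continuous_induced_dom

theorem continuous_star_cl (k : ℕ) : Continuous (star : Cl k → Cl k) := by
  have : (star : Cl k → Cl k) = (reverse ∘ₗ involute.toLinearMap : Cl k →ₗ[ℝ] Cl k) := by
    ext x; exact star_def x
  rw [this]
  exact IsModuleTopology.continuous_of_linearMap _

instance spinT2Space (k : ℕ) : T2Space (Spin k) :=
  T2Space.of_injective_continuous Subtype.val_injective (continuous_spin_val k)

instance spinContinuousMul (k : ℕ) : ContinuousMul (Spin k) where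
  continuous_mul := continuous_induced_rng.2
    (((continuous_spin_val k).comp continuous_fst).mul ((continuous_spin_val k).comp continuous_snd))

theorem neg_one_mem_spinGroup {k : ℕ} (hk : 0 < k) : (-1 : Cl k) ∈ spinGroup (negNormSq k) := by
  have he : ‖(EuclideanSpace.single ⟨0, hk⟩ 1 : CSp k)‖ = 1 := by simp
  rw [← ι_sq_unit he]
  exact mul_ι_mem_spinGroup he he

/-- The spin group is the union of the sets of even products of at most `2k` unit vectors and their
negatives. -/
theorem isCompact_range_spin {k : ℕ} (hk : 0 < k) :
    IsCompact (Set.range (Subtype.val : Spin k → Cl k)) := by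
  -- the products of `m` unit vectors
  let A : ℕ → Set (Cl k) := fun m =>
    Nat.rec {1} (fun _ B => (fun q : Cl k × Cl k => q.1 * q.2) ''
      ((ι (negNormSq k) '' Metric.sphere 0 1) ×ˢ B)) m
  have hA : ∀ m, IsCompact (A m) := fun m => by
    induction m with
    | zero => exact isCompact_singleton
    | succ m ih =>
      exact (((isCompact_sphere _ _).image (continuous_ι k)).prod ih).image continuous_mul
  have hA' : ∀ m x, x ∈ A m ↔ ∃ l : List (CSp k), (∀ v ∈ l, ‖v‖ = 1) ∧ l.length = m ∧
      x = vecProd l := fun m => by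
    induction m with
    | zero =>
      refine fun x => ⟨fun h => ⟨[], by simp, rfl, h⟩, ?_⟩
      rintro ⟨l, _, h, rfl⟩
      rw [List.length_eq_zero_iff.1 h]
      exact Set.mem_singleton _
    | succ m ih =>
      refine fun x => ⟨?_, ?_⟩
      · rintro ⟨⟨y, z⟩, ⟨⟨v, hv, rfl⟩, hz⟩, rfl⟩
        obtain ⟨l, h1, h2, rfl⟩ := (ih z).1 hz
        refine ⟨v :: l, ?_, by rw [List.length_cons, h2], (vecProd_cons v l).symm⟩
        intro w hw
        rcases List.mem_cons.1 hw with rfl | hw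
        exacts [mem_sphere_zero_iff_norm.1 hv, h1 w hw]
      · rintro ⟨l, h1, h2, rfl⟩
        match l, h2 with
        | v :: l, h2 =>
          refine ⟨(ι _ v, vecProd l), ⟨⟨v, ?_, rfl⟩,
            (ih _).2 ⟨l, fun w hw => h1 w (List.mem_cons_of_mem _ hw), ?_, rfl⟩⟩,
            (vecProd_cons v l).symm⟩
          · exact mem_sphere_zero_iff_norm.2 (h1 v List.mem_cons_self)
          · simpa using h2
  have : Set.range (Subtype.val : Spin k → Cl k) =
      ⋃ m ∈ {m | m ∈ Finset.range (2 * k + 1) ∧ Even m}, (A m ∪ (fun x => -x) '' A m) := by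
    ext x
    simp only [Set.mem_iUnion, Set.mem_union, Set.mem_image]
    constructor
    · rintro ⟨g, rfl⟩
      obtain ⟨l, h1, h2, h3, h4⟩ := exists_vecProd_eq g
      refine ⟨l.length, ⟨Finset.mem_range.2 (by omega), h3⟩, ?_⟩
      rcases h4 with h4 | h4
      · exact Or.inl ((hA' _ _).2 ⟨l, h1, rfl, h4⟩)
      · exact Or.inr ⟨vecProd l, (hA' _ _).2 ⟨l, h1, rfl, rfl⟩, h4.symm⟩
    · rintro ⟨m, ⟨_, hm⟩, h⟩
      have hpos : ∀ y ∈ A m, y ∈ spinGroup (negNormSq k) := fun y hy => by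
        obtain ⟨l, h1, rfl, rfl⟩ := (hA' _ _).1 hy
        exact vecProd_mem_spinGroup h1 hm
      rcases h with h | ⟨y, hy, rfl⟩
      · exact ⟨⟨x, hpos x h⟩, rfl⟩
      · refine ⟨⟨-y, ?_⟩, rfl⟩
        rw [← neg_one_mul]
        exact mul_mem (neg_one_mem_spinGroup hk) (hpos _ hy)
  rw [this]
  refine Set.Finite.isCompact_biUnion ((Finset.range (2 * k + 1)).finite_toSet.subset fun m hm => hm.1)
    fun m _ => (hA m).union ((hA m).image continuous_neg)

theorem compactSpace_spin {k : ℕ} (hk : 0 < k) : CompactSpace (Spin k) := by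
  rw [← isCompact_univ_iff, Subtype.isCompact_iff, Set.image_univ]
  exact isCompact_range_spin hk

/-- `ξ(g)` as a continuous linear map. -/
def rotCLM {k : ℕ} (g : Spin k) : CSp k →L[ℝ] CSp k := LinearMap.toContinuousLinearMap (rot g)

theorem continuous_rotCLM (k : ℕ) : Continuous (rotCLM : Spin k → (CSp k →L[ℝ] CSp k)) := by
  rw [continuous_clm_apply]
  intro v
  exact (IsModuleTopology.continuous_of_linearMap (vecPart k)).comp
    (((continuous_spin_val k).mul continuous_const).mul
      ((continuous_star_cl k).comp (continuous_spin_val k)))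

/-! ### The spinor representation is unitary -/

theorem cliffMul_apply {k : ℕ} (w : CSp k) (ψ : Spinor k) (S : Finset (Fin k)) :
    cliffMul k w ψ S = ∑ j, cliffCoeff w j S * ψ (symmDiff S {j}) := rfl

theorem conj_wedgeSign {k : ℕ} (j : Fin k) (S : Finset (Fin k)) :
    (starRingEnd ℂ) (wedgeSign j S) = wedgeSign j S := by
  simp only [wedgeSign, map_prod]
  refine Finset.prod_congr rfl fun i _ => ?_
  split_ifs <;> simp

theorem conj_cliffCoeff {k : ℕ} (w : CSp k) (j : Fin k) (S : Finset (Fin k)) :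
    (starRingEnd ℂ) (cliffCoeff w j S) = -cliffCoeff w j (symmDiff S {j}) := by
  simp only [cliffCoeff, map_mul, conj_wedgeSign, wedgeSign_symmDiff, lt_irrefl, if_false]
  by_cases h : j ∈ S <;> simp [h, Finset.mem_symmDiff]

theorem inner_cliffMul {k : ℕ} (w : CSp k) (ψ φ : Spinor k) :
    inner ℂ (cliffMul k w ψ) φ = -inner ℂ ψ (cliffMul k w φ) := by
  simp only [PiLp.inner_apply, cliffMul_apply, RCLike.inner_apply, map_sum, map_mul,
    Finset.mul_sum, Finset.sum_mul]
  rw [Finset.sum_comm, Finset.sum_comm (s := Finset.univ (α := Finset (Fin k))),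
    ← Finset.sum_neg_distrib]
  refine Finset.sum_congr rfl fun j _ => ?_
  have hinv : Function.Involutive fun S : Finset (Fin k) => symmDiff S {j} := fun S => by
    simp only [symmDiff_assoc, symmDiff_self, symmDiff_bot]
  rw [← Finset.sum_neg_distrib]
  refine (Equiv.sum_comp hinv.toPerm _).symm.trans (Finset.sum_congr rfl fun S _ => ?_)
  simp only [Function.Involutive.coe_toPerm, conj_cliffCoeff, hinv S]
  ring

/-- The spinor representation is a `*`-representation, as `v* = -v` for vectors `v` and vectors act by
skew-Hermitian operators. -/
theorem inner_cliffRep_star {k : ℕ} (x : Cl k) (ψ φ : Spinor k) :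
    inner ℂ (cliffRep k (star x) ψ) φ = inner ℂ ψ (cliffRep k x φ) := by
  induction x using CliffordAlgebra.left_induction generalizing ψ φ with
  | algebraMap r =>
    rw [CliffordAlgebra.star_algebraMap, AlgHom.commutes, Module.algebraMap_end_apply,
      Module.algebraMap_end_apply, ← Complex.coe_smul, ← Complex.coe_smul, inner_smul_left, inner_smul_right,
      Complex.conj_ofReal]
  | add x y hx hy =>
    rw [star_add, map_add, map_add, LinearMap.add_apply, LinearMap.add_apply, inner_add_left,
      inner_add_right, hx, hy]
  | ι_mul x w hx =>
    have hw : cliffRep k (ι (negNormSq k) w) = cliffMul k w := lift_ι_apply _ _ _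
    rw [star_mul, star_ι, map_mul, map_mul, map_neg, hw, Module.End.mul_apply, hx,
      Module.End.mul_apply, LinearMap.neg_apply, inner_neg_left, inner_cliffMul, neg_neg]

theorem inner_spinRep {k : ℕ} (g : Spin k) (ψ φ : Spinor k) :
    inner ℂ (spinRep k g ψ) (spinRep k g φ) = inner ℂ ψ φ := by
  rw [spinRep, ← inner_cliffRep_star, ← Module.End.mul_apply, ← map_mul,
    spinGroup.coe_star_mul_self, map_one, Module.End.one_apply]

theorem spinRep_one {k : ℕ} (ψ : Spinor k) : spinRep k 1 ψ = ψ := by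
  simp [spinRep]

theorem spinRep_mul {k : ℕ} (g h : Spin k) (ψ : Spinor k) :
    spinRep k (g * h) ψ = spinRep k g (spinRep k h ψ) := by
  simp [spinRep, Module.End.mul_apply]

/-! ### The lift to the spin group of the scalar rotations -/

/-- The rotation of the `j`-th coordinate of `ℂᵏ` by the angle of `v⁻²`, lifted to the spin group
as the product of the unit vectors `eⱼ` and `-v eⱼ`. -/
def planeRot {k : ℕ} (j : Fin k) (v : Circle) : Spin k :=
  ⟨ι (negNormSq k) (EuclideanSpace.single j 1) * ι (negNormSq k) (EuclideanSpace.single j (-v : ℂ)),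
    mul_ι_mem_spinGroup (by simp) (by simp [Circle.norm_coe])⟩

theorem reflection_single_apply {k : ℕ} (j : Fin k) {a : ℂ} (ha : ‖a‖ = 1) (w : CSp k) (l : Fin k) :
    (ℝ ∙ (EuclideanSpace.single j a : CSp k)).reflection w l =
      if l = j then a ^ 2 * (starRingEnd ℂ) (w j) else -w l := by
  have h1 : inner ℝ (EuclideanSpace.single j a : CSp k) w = ((starRingEnd ℂ) a * w j).re := by
    rw [inner_real_eq, EuclideanSpace.inner_single_left]
  have h2 : ‖(EuclideanSpace.single j a : CSp k)‖ = 1 := by simp [ha]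
  have h3 : a * (starRingEnd ℂ) a = 1 := by rw [Complex.mul_conj']; simp [ha]
  have h4 : (((starRingEnd ℂ) a * w j).re : ℂ) * 2 =
      (starRingEnd ℂ) a * w j + a * (starRingEnd ℂ) (w j) := by
    have := Complex.add_conj ((starRingEnd ℂ) a * w j)
    rw [map_mul, Complex.conj_conj] at this
    rw [this]; push_cast; ring
  rw [Submodule.reflection_singleton_apply, h1, h2]
  by_cases hl : l = j
  · subst hl
    simp only [PiLp.sub_apply, PiLp.smul_apply, PiLp.single_apply, if_true,
      Complex.real_smul, nsmul_eq_mul, RCLike.ofReal_real_eq_id, id, one_pow, div_one]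
    push_cast
    linear_combination a * h4 + w l * h3
  · simp [hl]

theorem rot_planeRot {k : ℕ} (j : Fin k) (v : Circle) (w : CSp k) (l : Fin k) :
    rot (planeRot j v) w l = if l = j then (v⁻¹ : ℂ) ^ 2 * w l else w l := by
  have h1 : rot (planeRot j v) w =
      (ℝ ∙ (EuclideanSpace.single j 1 : CSp k)).reflection
        ((ℝ ∙ (EuclideanSpace.single j (-v : ℂ) : CSp k)).reflection w) := by
    refine rot_eq_of_mul_eq ?_
    simp only [planeRot]
    rw [mul_assoc, ι_mul_ι_reflection (by simp), ← mul_assoc, ι_mul_ι_reflection (by simp), mul_assoc]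
  rw [h1, reflection_single_apply _ (by simp),
    reflection_single_apply _ (by simp [Circle.norm_coe]),
    reflection_single_apply _ (by simp [Circle.norm_coe])]
  by_cases hl : l = j
  · subst hl
    simp [← Circle.coe_inv_eq_conj]
  · simp [hl]

theorem cliffMul_single {k : ℕ} (j : Fin k) (a : ℂ) (ψ : Spinor k) (S : Finset (Fin k)) :
    cliffMul k (EuclideanSpace.single j a) ψ S =
      wedgeSign j S * (if j ∈ S then a else -(starRingEnd ℂ) a) * ψ (symmDiff S {j}) := by
  rw [cliffMul_apply, Finset.sum_eq_single j]
  · simp [cliffCoeff]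
  · intro l _ hl
    simp [cliffCoeff, hl]
  · simp

theorem spinRep_planeRot {k : ℕ} (j : Fin k) (v : Circle) (ψ : Spinor k) (S : Finset (Fin k)) :
    spinRep k (planeRot j v) ψ S = (if j ∈ S then (v⁻¹ : ℂ) else v) * ψ S := by
  have h : ∀ w, cliffRep k (ι (negNormSq k) w) = cliffMul k w := fun w => lift_ι_apply _ _ _
  rw [spinRep, planeRot, map_mul, h, h, Module.End.mul_apply, cliffMul_single, cliffMul_single,
    wedgeSign_symmDiff, symmDiff_assoc, symmDiff_self, symmDiff_bot]
  have h1 := wedgeSign_mul_self j S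
  by_cases hj : j ∈ S
  · simp only [hj, Finset.mem_symmDiff, Finset.mem_singleton, lt_irrefl, if_true, if_false,
      not_true_eq_false, and_false, or_false, map_neg, ← Circle.coe_inv_eq_conj, Circle.coe_inv]
    linear_combination (v⁻¹ : ℂ) * ψ S * h1
  · simp only [hj, Finset.mem_symmDiff, Finset.mem_singleton, lt_irrefl, if_true, if_false,
      not_false_eq_true, and_true, or_true, map_one]
    linear_combination (v : ℂ) * ψ S * h1

theorem continuous_planeRot {k : ℕ} (j : Fin k) : Continuous (planeRot j : Circle → Spin k) := by
  have : Continuous fun a : ℂ => (EuclideanSpace.single j a : CSp k) :=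
    (LinearMap.continuous_of_finiteDimensional
      (LinearMap.toSpanSingleton ℂ (CSp k) (EuclideanSpace.single j 1))).congr fun a => by
        ext i
        by_cases h : i = j <;> simp [h]
  have h1 : Continuous fun v : Circle => -(v : ℂ) := continuous_subtype_val.neg
  have h := (continuous_ι k).comp (this.comp h1)
  exact continuous_induced_rng.2 ((continuous_const_mul _).comp h)

/-- The simultaneous rotation of all coordinates of `ℂᵏ` by `v⁻²`, lifted to the spin group. -/
def sqLift (k : ℕ) (v : Circle) : Spin k := ((List.finRange k).map fun j => planeRot j v).prod

theorem continuous_sqLift (k : ℕ) : Continuous (sqLift k) :=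
  continuous_list_prod _ fun j _ => continuous_planeRot j

theorem rot_sqLift {k : ℕ} (v : Circle) (w : CSp k) : rot (sqLift k v) w = ((v ^ 2)⁻¹ : Circle) • w := by
  have key : ∀ l : List (Fin k), l.Nodup → ∀ i, rot (l.map fun j => planeRot j v).prod w i =
      if i ∈ l then (v⁻¹ : ℂ) ^ 2 * w i else w i := by
    intro l hl i
    induction l with
    | nil => simp [rot_one]
    | cons j l ih =>
      rw [List.nodup_cons] at hl
      rw [List.map_cons, List.prod_cons, rot_mul, rot_planeRot, ih hl.2]
      by_cases hi : i = j
      · subst hi; simp [hl.1]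
      · simp [hi]
  ext i
  rw [sqLift, key _ (List.nodup_finRange k) i]
  simp [Circle.smul_def]

theorem spinRep_sqLift {k : ℕ} (v : Circle) (ψ : Spinor k) (S : Finset (Fin k)) :
    spinRep k (sqLift k v) ψ S = (v : ℂ) ^ ((k : ℤ) - 2 * S.card) * ψ S := by
  have key : ∀ l : List (Fin k), spinRep k (l.map fun j => planeRot j v).prod ψ S =
      (l.map fun j => if j ∈ S then (v⁻¹ : ℂ) else v).prod * ψ S := by
    intro l
    induction l with
    | nil => simp [spinRep_one]
    | cons j l ih =>
      rw [List.map_cons, List.prod_cons, spinRep_mul, spinRep_planeRot, ih, List.map_cons,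
        List.prod_cons, mul_assoc]
  have hv : (v : ℂ) ≠ 0 := Circle.coe_ne_zero v
  have hc : S.card ≤ k := by simpa using S.card_le_univ
  rw [sqLift, key, ← List.ofFn_eq_map, List.prod_ofFn, Finset.prod_ite, Finset.prod_const, Finset.prod_const,
    Finset.filter_mem_eq_inter, Finset.univ_inter, Finset.filter_not, Finset.filter_mem_eq_inter,
    Finset.univ_inter, ← Finset.compl_eq_univ_sdiff, Finset.card_compl, Fintype.card_fin,
    inv_pow, ← zpow_natCast, ← zpow_natCast, ← zpow_neg, ← zpow_add₀ hv]
  congr 2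
  rw [Nat.cast_sub hc]
  ring

/-- The elements `g` and `-g` of the spin group are distinguished by the spinor representation. -/
theorem spin_ext {k : ℕ} {g h : Spin k} (h1 : ∀ v, rot g v = rot h v)
    (h2 : ∀ ψ, spinRep k g ψ = spinRep k h ψ) : g = h := by
  rcases eq_or_eq_neg_of_rot_eq h1 with h3 | h3
  · exact Subtype.ext h3
  · exfalso
    have h4 := h2 (spinRep k h⁻¹ (EuclideanSpace.single ∅ 1))
    rw [spinRep, h3, map_neg, LinearMap.neg_apply, ← spinRep, ← spinRep_mul, mul_inv_cancel, spinRep_one] at h4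
    have h5 := congrArg (fun ψ : Spinor k => ψ ∅) h4
    simp only [PiLp.neg_apply, PiLp.single_apply, if_true] at h5
    norm_num at h5

/-- A square root of a unit complex number. -/
def circleSqrt (u : Circle) : Circle := Circle.exp (Complex.arg u / 2)

theorem circleSqrt_sq (u : Circle) : circleSqrt u ^ 2 = u := by
  rw [circleSqrt, ← Circle.exp_nsmul, nsmul_eq_mul]
  rw [Nat.cast_ofNat, mul_div_cancel₀ _ two_ne_zero, Circle.exp_arg]

/-- The lift `U₁ → Spin₂ₖ` of the homomorphism `u ↦ u⁻¹ id` to the rotation group. For even `k` it does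
not depend on the choice of the square root of `u`, and is a continuous homomorphism. -/
def circleLift (k : ℕ) (u : Circle) : Spin k := sqLift k (circleSqrt u)

theorem rot_circleLift {k : ℕ} (u : Circle) (w : CSp k) : rot (circleLift k u) w = u⁻¹ • w := by
  rw [circleLift, rot_sqLift, circleSqrt_sq]

theorem spinRep_circleLift {k : ℕ} (hk : Even k) (u : Circle) (ψ : Spinor k)
    (S : Finset (Fin k)) :
    spinRep k (circleLift k u) ψ S = (u : ℂ) ^ ((k : ℤ) / 2 - S.card) * ψ S := by
  obtain ⟨m, rfl⟩ := hk
  rw [circleLift, spinRep_sqLift]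
  conv_rhs => rw [← circleSqrt_sq u]
  rw [Circle.coe_pow, ← zpow_natCast, ← zpow_mul]
  congr 2
  push_cast
  omega

/-- `circleLift k u` is determined by its actions on vectors and on spinors. -/
theorem circleLift_eq_of {k : ℕ} (hk : Even k) {u : Circle} {g : Spin k} (h1 : ∀ w, rot g w = u⁻¹ • w)
    (h2 : ∀ ψ S, spinRep k g ψ S = (u : ℂ) ^ ((k : ℤ) / 2 - S.card) * ψ S) : g = circleLift k u :=
  spin_ext (fun v => by rw [h1, rot_circleLift]) fun ψ => by
    ext S
    rw [h2, spinRep_circleLift hk]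

theorem circleLift_one {k : ℕ} (hk : Even k) : circleLift k 1 = 1 :=
  (circleLift_eq_of hk (by simp [rot_one]) (by simp [spinRep_one])).symm

theorem circleLift_mul {k : ℕ} (hk : Even k) (u v : Circle) :
    circleLift k (u * v) = circleLift k u * circleLift k v :=
  (circleLift_eq_of hk (fun w => by rw [rot_mul, rot_circleLift, rot_circleLift, mul_inv, mul_smul])
    (fun ψ S => by
      rw [spinRep_mul, spinRep_circleLift hk, spinRep_circleLift hk, Circle.coe_mul, mul_zpow,
        mul_assoc])).symm

theorem circleLift_sq {k : ℕ} (hk : Even k) (v : Circle) : circleLift k (v ^ 2) = sqLift k v :=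
  (circleLift_eq_of hk (fun w => rot_sqLift v w) (fun ψ S => by
    obtain ⟨m, rfl⟩ := hk
    rw [spinRep_sqLift, Circle.coe_pow, ← zpow_natCast, ← zpow_mul]
    congr 2
    push_cast
    omega)).symm

/-- The composition of `circleLift k` with the quotient map `v ↦ v²` is `sqLift k`. -/
theorem continuous_circleLift {k : ℕ} (hk : Even k) : Continuous (circleLift k) := by
  have hq : Topology.IsQuotientMap fun v : Circle => v ^ 2 :=
    (continuous_pow 2).isClosedMap.isQuotientMap (continuous_pow 2)
      fun u => ⟨circleSqrt u, circleSqrt_sq u⟩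
  rw [hq.continuous_iff]
  exact (continuous_sqLift k).congr fun v => (circleLift_sq hk v).symm

end SpinGroup

section NormalBundle

open InnerProductSpace

/-! ### Tangent vectors of complex projective space -/

/-- The operator `w z* + z w*`, the velocity at `[z]`, `‖z‖ = 1`, of the curve `t ↦ [z + t w]` if
`w` is orthogonal to `z`. -/
def symOp {n : ℕ} (z w : CSp (n + 1)) : Op n := rankOne ℂ w z + rankOne ℂ z w

theorem symOp_apply {n : ℕ} (z w v : CSp (n + 1)) :
    symOp z w v = inner ℂ z v • w + inner ℂ w v • z := rfl

theorem metric_symOp {n : ℕ} (z w z' w' : CSp (n + 1)) :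
    metric n (symOp z w) (symOp z' w') =
      (inner ℂ z w' * inner ℂ z' w + inner ℂ z z' * inner ℂ w' w).re := by
  have h : ∀ a b c e : CSp (n + 1), rankOne ℂ a b * rankOne ℂ c e =
      (inner ℂ b c • rankOne ℂ a e : Op n) := fun a b c e => rankOne_comp_rankOne a b c e
  have h1 := inner_conj_symm (𝕜 := ℂ) z w'
  have h2 := inner_conj_symm (𝕜 := ℂ) z' w
  have h3 := inner_conj_symm (𝕜 := ℂ) z z'
  have h4 := inner_conj_symm (𝕜 := ℂ) w' w
  rw [metric, symOp, symOp, add_mul, mul_add, mul_add, h, h, h, h]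
  simp only [ContinuousLinearMap.toLinearMap_add, ContinuousLinearMap.toLinearMap_smul, map_add,
    map_smul, trace_rankOne, smul_eq_mul, Complex.add_re]
  rw [← h1, ← h2, ← h3, ← h4]
  simp only [Complex.mul_re, Complex.conj_re, Complex.conj_im]
  ring

theorem eq_mk_of_mem {m : ℕ} {x : CP m} {z : CSp (m + 1)} (hz : z ∈ x.submodule) (hz0 : z ≠ 0) :
    x = Projectivization.mk ℂ z hz0 := by
  induction x using Projectivization.ind with
  | h v hv =>
    rw [Projectivization.submodule_mk, Submodule.mem_span_singleton] at hz
    obtain ⟨a, ha⟩ := hz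
    exact ((Projectivization.mk_eq_mk_iff' ℂ _ _ _ _).2 ⟨a, ha⟩).symm

theorem ne_zero_of_norm_eq_one {m : ℕ} {z : CSp m} (hz : ‖z‖ = 1) : z ≠ 0 := by
  rintro rfl
  simp at hz

theorem exists_unit_mem {m : ℕ} (x : CP m) : ∃ z ∈ x.submodule, ‖z‖ = 1 := by
  have h : x.rep ∈ x.submodule := by
    rw [Projectivization.submodule_eq]; exact Submodule.mem_span_singleton_self _
  refine ⟨((‖x.rep‖⁻¹ : ℝ) : ℂ) • x.rep, Submodule.smul_mem _ _ h, ?_⟩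
  rw [norm_smul, Complex.norm_real, norm_inv, norm_norm,
    inv_mul_cancel₀ (norm_ne_zero_iff.2 x.rep_nonzero)]

theorem lineProj_mk {m : ℕ} {z : CSp (m + 1)} (hz : z ≠ 0) :
    lineProj m (Projectivization.mk ℂ z hz) = (((‖z‖ ^ 2)⁻¹ : ℝ)) • rankOne ℂ z z := by
  ext1 v
  have : (Projectivization.mk ℂ z hz).submodule.starProjection v = (ℂ ∙ z).starProjection v := by
    congr 1
  rw [lineProj, this, Submodule.starProjection_singleton, smul_apply, rankOne_apply,
    ← Complex.coe_smul, smul_smul, div_eq_inv_mul]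
  push_cast
  rfl

theorem lineProj_eq_rankOne {m : ℕ} {x : CP m} {z : CSp (m + 1)} (hz : z ∈ x.submodule)
    (hz1 : ‖z‖ = 1) : lineProj m x = rankOne ℂ z z := by
  rw [eq_mk_of_mem hz (ne_zero_of_norm_eq_one hz1), lineProj_mk, hz1]
  simp

theorem mem_submodule_iff {m : ℕ} (x : CP m) (v : CSp (m + 1)) :
    v ∈ x.submodule ↔ lineProj m x v = v :=
  Submodule.starProjection_eq_self_iff.symm

theorem lineProj_injective (m : ℕ) : Function.Injective (lineProj m) := by
  intro x y h
  refine Projectivization.submodule_injective (Submodule.ext fun v => ?_)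
  rw [mem_submodule_iff, mem_submodule_iff, h]

/-- The velocity vectors of differentiable curves of `ℂPⁿ`: differentiate `P² = P` and `P* = P`. -/
theorem velocity_eq_symOp {n : ℕ} {c : ℝ → CP n} {X : Op n} {z : CSp (n + 1)}
    (hz : z ∈ (c 0).submodule) (hz1 : ‖z‖ = 1) (hX : HasDerivAt (fun t => lineProj n (c t)) X 0) :
    inner ℂ z (X z) = 0 ∧ X = symOp z (X z) := by
  have hP := lineProj_eq_rankOne hz hz1
  have h1 : X = X * rankOne ℂ z z + rankOne ℂ z z * X := by
    have h := hX.mul hX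
    have h' : (fun t => lineProj n (c t)) * (fun t => lineProj n (c t)) = fun t => lineProj n (c t) := by
      funext t
      exact (c t).submodule.isIdempotentElem_starProjection
    rw [h', hP] at h
    exact hX.unique h
  have h2 : star X = X := by
    have h := hX.star
    have h' : (fun t => star (lineProj n (c t))) = fun t => lineProj n (c t) := by
      funext t
      exact isSelfAdjoint_starProjection (c t).submodule
    rw [h'] at h
    exact h.unique hX
  have h3 : rankOne ℂ z z * X = rankOne ℂ z (X z) := by
    ext1 v
    have : inner ℂ z (X v) = inner ℂ (X z) v := by
      conv_rhs => rw [← h2, ContinuousLinearMap.star_eq_adjoint, ContinuousLinearMap.adjoint_inner_left]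
    rw [mul_apply_eq_comp, rankOne_apply, rankOne_apply, this]
  have h4 : X * rankOne ℂ z z = rankOne ℂ (X z) z := by
    ext1 v
    rw [mul_apply_eq_comp, rankOne_apply, rankOne_apply, map_smul]
  rw [h3, h4] at h1
  refine ⟨?_, h1⟩
  have h5 := congrArg (fun T : Op n => inner ℂ z (T z)) h1
  simp only [add_apply, rankOne_apply, inner_add_right, inner_smul_right,
    inner_self_eq_norm_sq_to_K, hz1] at h5
  have h6 : inner ℂ (X z) z = inner ℂ z (X z) := by
    conv_lhs => rw [← h2, ContinuousLinearMap.star_eq_adjoint, ContinuousLinearMap.adjoint_inner_left]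
  rw [h6] at h5
  simpa using h5

/-- The curve `t ↦ [z + t w]` and its velocity. -/
theorem lineProj_curve {n : ℕ} {z w : CSp (n + 1)} (hz : ‖z‖ = 1) (hw : inner ℂ z w = 0) :
    ∃ h : ∀ t : ℝ, z + t • w ≠ 0,
      ContDiff ℝ (⊤ : ℕ∞) (fun t => lineProj n (Projectivization.mk ℂ (z + t • w) (h t))) ∧
      HasDerivAt (fun t => lineProj n (Projectivization.mk ℂ (z + t • w) (h t))) (symOp z w) 0 := by
  have hn : ∀ t : ℝ, ‖z + t • w‖ ^ 2 = 1 + t ^ 2 * ‖w‖ ^ 2 := fun t => by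
    rw [norm_add_sq_real, real_inner_smul_right, inner_real_eq, hw, hz, norm_smul, mul_pow,
      Real.norm_eq_abs, sq_abs]
    simp
  have hpos : ∀ t : ℝ, 0 < 1 + t ^ 2 * ‖w‖ ^ 2 := fun t => by positivity
  have hne : ∀ t : ℝ, z + t • w ≠ 0 := fun t h => by
    have := hn t
    rw [h] at this
    have := hpos t
    simp_all
  have hf : (fun t : ℝ => lineProj n (Projectivization.mk ℂ (z + t • w) (hne t))) =
      fun t : ℝ => (1 + t ^ 2 * ‖w‖ ^ 2)⁻¹ •
        ((rankOne ℂ z z : Op n) + t • symOp z w + t ^ 2 • rankOne ℂ w w) := by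
    funext t
    rw [lineProj_mk, hn]
    congr 1
    ext1 v
    simp only [add_apply, smul_apply, symOp_apply,
      rankOne_apply, inner_add_left, ← Complex.coe_smul, inner_smul_left, Complex.conj_ofReal]
    module
  refine ⟨hne, ?_, ?_⟩
  · rw [hf]
    refine ContDiff.smul (ContDiff.inv (by fun_prop) fun t => (hpos t).ne') ?_
    fun_prop
  · rw [hf]
    have h1 : HasDerivAt (fun t : ℝ => (1 + t ^ 2 * ‖w‖ ^ 2)⁻¹) 0 0 := by
      have h := (((hasDerivAt_id (0 : ℝ)).pow 2).mul_const (‖w‖ ^ 2)).const_add 1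
      exact (h.inv (by simp)).congr_deriv (by simp)
    have h2 : HasDerivAt (fun t : ℝ => (rankOne ℂ z z : Op n) + t • symOp z w + t ^ 2 • rankOne ℂ w w)
        (symOp z w) 0 := by
      have h := (((hasDerivAt_id (0 : ℝ)).smul_const (symOp z w)).const_add (rankOne ℂ z z : Op n)).add
        (((hasDerivAt_id (0 : ℝ)).pow 2).smul_const (rankOne ℂ w w : Op n))
      exact h.congr_deriv (by simp)
    exact (h1.smul h2).congr_deriv (by simp)

/-! ### The normal bundle and its frames -/

/-- The linear map `ℂⁿ⁻ᵈ → ℂⁿ⁺¹`, `w ↦ (0, w)`, onto the orthogonal complement of `ℂᵈ⁺¹`. -/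
def normalExtend (d n : ℕ) : CSp (n - d) →ₗ[ℂ] CSp (n + 1) where
  toFun w := WithLp.toLp 2 fun i => if h : d + 1 ≤ (i : ℕ) then w ⟨i - (d + 1), by omega⟩ else 0
  map_add' z w := by ext i; by_cases h : d + 1 ≤ (i : ℕ) <;> simp [h, -Order.add_one_le_iff]
  map_smul' a z := by ext i; by_cases h : d + 1 ≤ (i : ℕ) <;> simp [h, -Order.add_one_le_iff]

/-- The splitting of the coordinates of `ℂⁿ⁺¹`. -/
def coordSplit {d n : ℕ} (hdn : d < n) : Fin (d + 1) ⊕ Fin (n - d) ≃ Fin (n + 1) :=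
  finSumFinEquiv.trans (finCongr (by omega))

theorem zeroExtend_inl {d n : ℕ} (hdn : d < n) (z : CSp (d + 1)) (i : Fin (d + 1)) :
    zeroExtend d n z (coordSplit hdn (Sum.inl i)) = z i := by
  simp [zeroExtend, coordSplit, -Order.lt_add_one_iff]

theorem zeroExtend_inr {d n : ℕ} (hdn : d < n) (z : CSp (d + 1)) (i : Fin (n - d)) :
    zeroExtend d n z (coordSplit hdn (Sum.inr i)) = 0 := by
  simp [zeroExtend, coordSplit, -Order.lt_add_one_iff]

theorem normalExtend_inl {d n : ℕ} (hdn : d < n) (w : CSp (n - d)) (i : Fin (d + 1)) :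
    normalExtend d n w (coordSplit hdn (Sum.inl i)) = 0 :=
  dif_neg (by simp [coordSplit]; omega)

theorem normalExtend_inr {d n : ℕ} (hdn : d < n) (w : CSp (n - d)) (i : Fin (n - d)) :
    normalExtend d n w (coordSplit hdn (Sum.inr i)) = w i := by
  simp [normalExtend, coordSplit, -Order.add_one_le_iff]

theorem inner_split {d n : ℕ} (hdn : d < n) (v w : CSp (n + 1)) :
    inner ℂ v w = ∑ i, inner ℂ (v (coordSplit hdn (Sum.inl i))) (w (coordSplit hdn (Sum.inl i))) +
      ∑ i, inner ℂ (v (coordSplit hdn (Sum.inr i))) (w (coordSplit hdn (Sum.inr i))) := by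
  rw [PiLp.inner_apply, ← (coordSplit hdn).sum_comp, Fintype.sum_sum_type]

theorem inner_zeroExtend {d n : ℕ} (hdn : d < n) (z z' : CSp (d + 1)) :
    inner ℂ (zeroExtend d n z) (zeroExtend d n z') = inner ℂ z z' := by
  simp only [inner_split hdn, zeroExtend_inl, zeroExtend_inr, inner_zero_left,
    Finset.sum_const_zero, add_zero, PiLp.inner_apply]

theorem inner_normalExtend {d n : ℕ} (hdn : d < n) (w w' : CSp (n - d)) :
    inner ℂ (normalExtend d n w) (normalExtend d n w') = inner ℂ w w' := by
  simp only [inner_split hdn, normalExtend_inl, normalExtend_inr, inner_zero_left,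
    Finset.sum_const_zero, zero_add, PiLp.inner_apply]

theorem inner_zeroExtend_normalExtend {d n : ℕ} (hdn : d < n) (z : CSp (d + 1)) (w : CSp (n - d)) :
    inner ℂ (zeroExtend d n z) (normalExtend d n w) = 0 := by
  simp only [inner_split hdn, zeroExtend_inl, zeroExtend_inr, normalExtend_inl, inner_zero_left,
    inner_zero_right, Finset.sum_const_zero, add_zero]

theorem inner_normalExtend_zeroExtend {d n : ℕ} (hdn : d < n) (z : CSp (d + 1)) (w : CSp (n - d)) :
    inner ℂ (normalExtend d n w) (zeroExtend d n z) = 0 := by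
  rw [← inner_conj_symm, inner_zeroExtend_normalExtend hdn, map_zero]

theorem exists_eq_extend_add {d n : ℕ} (hdn : d < n) (v : CSp (n + 1)) :
    ∃ z w, v = zeroExtend d n z + normalExtend d n w := by
  refine ⟨WithLp.toLp 2 fun i => v (coordSplit hdn (Sum.inl i)),
    WithLp.toLp 2 fun i => v (coordSplit hdn (Sum.inr i)), ?_⟩
  ext i
  obtain ⟨i | i, rfl⟩ := (coordSplit hdn).surjective i
  · rw [PiLp.add_apply, zeroExtend_inl, normalExtend_inl, add_zero]
  · rw [PiLp.add_apply, zeroExtend_inr, normalExtend_inr, zero_add]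

theorem norm_zeroExtend {d n : ℕ} (hdn : d < n) (z : CSp (d + 1)) : ‖zeroExtend d n z‖ = ‖z‖ := by
  rw [@norm_eq_sqrt_re_inner ℂ, inner_zeroExtend hdn, ← norm_eq_sqrt_re_inner]

theorem zeroExtend_mem {d n : ℕ} (hdn : d < n) {x : CP d} {z : CSp (d + 1)} (hz : z ∈ x.submodule) :
    zeroExtend d n z ∈ (incl hdn x).submodule := by
  induction x using Projectivization.ind with
  | h v hv =>
    rw [Projectivization.submodule_mk, Submodule.mem_span_singleton] at hz
    obtain ⟨a, rfl⟩ := hz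
    rw [incl, Projectivization.map_mk, Projectivization.submodule_mk, map_smul]
    exact Submodule.smul_mem _ _ (Submodule.mem_span_singleton_self _)

theorem pos_eq_rankOne {d n : ℕ} (hdn : d < n) {x : CP d} {z : CSp (d + 1)} (hz : z ∈ x.submodule)
    (hz1 : ‖z‖ = 1) : pos hdn x = rankOne ℂ (zeroExtend d n z) (zeroExtend d n z) :=
  lineProj_eq_rankOne (zeroExtend_mem hdn hz) (by rw [norm_zeroExtend hdn, hz1])

theorem pos_injective {d n : ℕ} (hdn : d < n) : Function.Injective (pos hdn) :=
  (lineProj_injective n).comp (Projectivization.map_injective _ (zeroExtend_injective hdn))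

/-- The frame `w ↦ (0, w) z* + z (0, w)*` of the normal space at `[z]`, which depends linearly over
`ℝ` on `z` and `w`. -/
def normalFrame (d n : ℕ) : CSp (d + 1) →L[ℝ] CSp (n - d) →L[ℝ] Op n :=
  LinearMap.toContinuousLinearMap
    { toFun := fun z => LinearMap.toContinuousLinearMap
        { toFun := fun w => symOp (zeroExtend d n z) (normalExtend d n w)
          map_add' := fun w w' => by simp only [symOp, map_add, add_apply]; abel
          map_smul' := fun a w => by
            simp only [symOp, RingHom.id_apply, ← Complex.coe_smul, map_smul, map_smulₛₗ,
              Complex.conj_ofReal, smul_apply, smul_add] }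
      map_add' := fun z z' => by
        ext1 w
        simp only [symOp, map_add, add_apply, LinearMap.coe_toContinuousLinearMap', LinearMap.coe_mk, AddHom.coe_mk]
        abel
      map_smul' := fun a z => by
        ext1 w
        simp only [symOp, RingHom.id_apply, ← Complex.coe_smul, map_smul, map_smulₛₗ,
          Complex.conj_ofReal, smul_apply, smul_add,
          LinearMap.coe_toContinuousLinearMap', LinearMap.coe_mk, AddHom.coe_mk] }

theorem normalFrame_apply {d n : ℕ} (z : CSp (d + 1)) (w : CSp (n - d)) :
    normalFrame d n z w = symOp (zeroExtend d n z) (normalExtend d n w) := rfl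

theorem normalFrame_smul {d n : ℕ} (u : Circle) (z : CSp (d + 1)) (w : CSp (n - d)) :
    normalFrame d n (u • z) w = normalFrame d n z (u⁻¹ • w) := by
  simp only [normalFrame_apply, symOp, Circle.smul_def, map_smul, map_smulₛₗ, smul_apply,
    Circle.coe_inv_eq_conj, Complex.conj_conj]

theorem metric_normalFrame {d n : ℕ} (hdn : d < n) (z z' : CSp (d + 1)) (w w' : CSp (n - d)) :
    metric n (normalFrame d n z w) (normalFrame d n z' w') = (inner ℂ z z' * inner ℂ w' w).re := by
  rw [normalFrame_apply, normalFrame_apply, metric_symOp, inner_zeroExtend_normalExtend hdn,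
    inner_zeroExtend hdn, inner_normalExtend hdn, zero_mul, zero_add]

theorem metric_normalFrame_unit {d n : ℕ} (hdn : d < n) {z : CSp (d + 1)} (hz : ‖z‖ = 1)
    (w w' : CSp (n - d)) :
    metric n (normalFrame d n z w) (normalFrame d n z w') = (inner ℂ w w').re := by
  rw [metric_normalFrame hdn, inner_self_eq_norm_sq_to_K, hz, RCLike.ofReal_one, one_pow, one_mul]
  exact inner_re_symm (𝕜 := ℂ) w' w

theorem symOp_mem_tangentSpan {n : ℕ} {x : CP n} {z w : CSp (n + 1)} (hz : z ∈ x.submodule)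
    (hz1 : ‖z‖ = 1) (hw : inner ℂ z w = 0) : symOp z w ∈ tangentSpan (lineProj n) x := by
  obtain ⟨h, h1, h2⟩ := lineProj_curve hz1 hw
  refine Submodule.subset_span ⟨fun t => Projectivization.mk ℂ (z + t • w) (h t), ?_, h1, h2⟩
  rw [eq_mk_of_mem hz (ne_zero_of_norm_eq_one hz1)]
  simp

theorem symOp_mem_tangentSpan_pos {d n : ℕ} (hdn : d < n) {x : CP d} {z w : CSp (d + 1)}
    (hz : z ∈ x.submodule) (hz1 : ‖z‖ = 1) (hw : inner ℂ z w = 0) :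
    symOp (zeroExtend d n z) (zeroExtend d n w) ∈ tangentSpan (pos hdn) x := by
  obtain ⟨h, h1, h2⟩ := lineProj_curve (z := zeroExtend d n z) (w := zeroExtend d n w)
    (by rw [norm_zeroExtend hdn, hz1]) (by rw [inner_zeroExtend hdn, hw])
  have he : ∀ t : ℝ, zeroExtend d n (z + t • w) = zeroExtend d n z + t • zeroExtend d n w :=
    fun t => by rw [map_add, ← Complex.coe_smul, map_smul, Complex.coe_smul]
  have h0 : ∀ t : ℝ, z + t • w ≠ 0 := fun t ht => h t (by rw [← he, ht, map_zero])
  have hp : (fun t : ℝ => lineProj n (Projectivization.mk ℂ _ (h t))) =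
      fun t : ℝ => pos hdn (Projectivization.mk ℂ (z + t • w) (h0 t)) := by
    funext t
    simp only [pos, incl, Projectivization.map_mk, he]
  rw [hp] at h1 h2
  refine Submodule.subset_span ⟨fun t => Projectivization.mk ℂ (z + t • w) (h0 t), ?_, h1, h2⟩
  rw [eq_mk_of_mem hz (ne_zero_of_norm_eq_one hz1)]
  simp

theorem exists_eq_symOp {n : ℕ} {x : CP n} {z : CSp (n + 1)} {X : Op n} (hz : z ∈ x.submodule)
    (hz1 : ‖z‖ = 1) (hX : X ∈ tangentSpan (lineProj n) x) :
    ∃ w, inner ℂ z w = 0 ∧ X = symOp z w := by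
  induction hX using Submodule.span_induction with
  | mem X hX =>
    obtain ⟨c, rfl, _, hc⟩ := hX
    exact ⟨X z, velocity_eq_symOp hz hz1 hc⟩
  | zero => exact ⟨0, by simp [symOp]⟩
  | add X Y _ _ hX hY =>
    obtain ⟨v, hv, rfl⟩ := hX
    obtain ⟨w, hw, rfl⟩ := hY
    refine ⟨v + w, by rw [inner_add_right, hv, hw, add_zero], ?_⟩
    simp only [symOp, map_add, add_apply]
    abel
  | smul a X _ hX =>
    obtain ⟨v, hv, rfl⟩ := hX
    refine ⟨(a : ℂ) • v, by rw [inner_smul_right, hv, mul_zero], ?_⟩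
    simp only [symOp, map_smul, map_smulₛₗ, Complex.conj_ofReal, smul_apply, ← Complex.coe_smul,
      smul_add]

theorem metric_add_right {n : ℕ} (X Y Z : Op n) :
    metric n X (Y + Z) = metric n X Y + metric n X Z := by
  simp only [metric, mul_add, ContinuousLinearMap.toLinearMap_add, map_add, Complex.add_re]
  ring

theorem metric_smul_right {n : ℕ} (X Y : Op n) (a : ℝ) : metric n X (a • Y) = a * metric n X Y := by
  have e : ((X * (a • Y) : Op n) : CSp (n + 1) →ₗ[ℂ] CSp (n + 1)) =
      (a : ℂ) • ((X * Y : Op n) : CSp (n + 1) →ₗ[ℂ] CSp (n + 1)) := by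
    ext v
    simp
  rw [metric, metric, e, map_smul, smul_eq_mul, Complex.re_ofReal_mul]
  ring

theorem metric_comm {n : ℕ} (X Y : Op n) : metric n X Y = metric n Y X := by
  rw [metric, metric]
  congr 2
  exact LinearMap.trace_mul_comm ℂ (X : CSp (n + 1) →ₗ[ℂ] CSp (n + 1)) Y

/-- The vectors `(0, w) z* + z (0, w)*` are orthogonal to `ℂPᵈ`. -/
theorem metric_normalFrame_tangent {d n : ℕ} (hdn : d < n) {x : CP d} {z : CSp (d + 1)}
    (hz : z ∈ x.submodule) (hz1 : ‖z‖ = 1) (w : CSp (n - d)) {Y : Op n}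
    (hY : Y ∈ tangentSpan (pos hdn) x) : metric n (normalFrame d n z w) Y = 0 := by
  induction hY using Submodule.span_induction with
  | mem Y hY =>
    obtain ⟨c, rfl, _, hc⟩ := hY
    have h1 : ‖zeroExtend d n z‖ = 1 := by rw [norm_zeroExtend hdn, hz1]
    obtain ⟨h2, h3⟩ := velocity_eq_symOp (c := fun t => incl hdn (c t)) (zeroExtend_mem hdn hz) h1 hc
    -- the curve stays in `ℂPᵈ`, so its velocity has no component in the last coordinates
    have h4 : inner ℂ (normalExtend d n w) (Y (zeroExtend d n z)) = 0 := by
      let L : Op n →L[ℝ] ℂ := ContinuousLinearMap.restrictScalars ℝ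
        (innerSL ℂ (normalExtend d n w) ∘L ContinuousLinearMap.apply ℂ _ (zeroExtend d n z))
      have h6 : HasDerivAt (L ∘ fun t => pos hdn (c t)) (L Y) 0 :=
        L.hasFDerivAt.comp_hasDerivAt (0 : ℝ) hc
      have h7 : (L ∘ fun t => pos hdn (c t)) = fun _ => 0 := by
        funext t
        obtain ⟨y, hy, hy1⟩ := exists_unit_mem (c t)
        change inner ℂ (normalExtend d n w) (pos hdn (c t) (zeroExtend d n z)) = 0
        rw [pos_eq_rankOne hdn hy hy1, rankOne_apply, inner_smul_right,
          inner_normalExtend_zeroExtend hdn, mul_zero]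
      rw [h7] at h6
      exact h6.unique (hasDerivAt_const _ _)
    rw [h3, normalFrame_apply, metric_symOp, inner_zeroExtend_normalExtend hdn, mul_zero, zero_add]
    rw [← inner_conj_symm (Y _), h4, map_zero, mul_zero, Complex.zero_re]
  | zero => simp [metric]
  | add X Y _ _ hX hY => rw [metric_add_right, hX, hY, add_zero]
  | smul a X _ hX => rw [metric_smul_right, hX, mul_zero]

/-- The normal space at `[z]` consists of the operators `(0, w) z* + z (0, w)*`. -/
theorem mem_normalSpace_iff {d n : ℕ} (hdn : d < n) {x : CP d} {z : CSp (d + 1)}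
    (hz : z ∈ x.submodule) (hz1 : ‖z‖ = 1) (X : Op n) :
    X ∈ normalSpace hdn x ↔ ∃ w, normalFrame d n z w = X := by
  have h1 : ‖zeroExtend d n z‖ = 1 := by rw [norm_zeroExtend hdn, hz1]
  constructor
  · rintro ⟨hX, hX0⟩
    obtain ⟨v, hv, rfl⟩ := exists_eq_symOp (zeroExtend_mem hdn hz) h1 hX
    obtain ⟨a, w, rfl⟩ := exists_eq_extend_add hdn v
    rw [inner_add_right, inner_zeroExtend hdn, inner_zeroExtend_normalExtend hdn, add_zero] at hv
    have h := hX0 _ (symOp_mem_tangentSpan_pos hdn hz hz1 hv)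
    simp only [metric_symOp, inner_zeroExtend hdn, hv, inner_add_right, zero_mul, zero_add, add_zero,
      inner_zeroExtend_normalExtend hdn, inner_self_eq_norm_sq_to_K, hz1] at h
    have ha : a = 0 := by
      have : ‖a‖ ^ 2 = 0 := by
        rw [← Complex.ofReal_re (‖a‖ ^ 2)]
        simpa using h
      simpa using this
    exact ⟨w, by rw [normalFrame_apply, ha, map_zero, zero_add]⟩
  · rintro ⟨w, rfl⟩
    exact ⟨symOp_mem_tangentSpan (zeroExtend_mem hdn hz) h1 (inner_zeroExtend_normalExtend hdn z w),
      fun Y hY => metric_normalFrame_tangent hdn hz hz1 w hY⟩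

theorem isUnitaryFrame_normalFrame {d n : ℕ} (hdn : d < n) {x : CP d} {z : CSp (d + 1)}
    (hz : z ∈ x.submodule) (hz1 : ‖z‖ = 1) : IsUnitaryFrame hdn x (normalFrame d n z) := by
  refine ⟨⟨?_, metric_normalFrame_unit hdn hz1⟩, fun v => ?_⟩
  · ext X
    exact (mem_normalSpace_iff hdn hz hz1 X).symm
  · have h1 : ‖zeroExtend d n z‖ = 1 := by rw [norm_zeroExtend hdn, hz1]
    rw [cplxStr, pos_eq_rankOne hdn hz hz1, normalFrame_apply, normalFrame_apply]
    ext1 y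
    simp only [symOp_apply, smul_apply, sub_apply, mul_apply_eq_comp, rankOne_apply, map_smul,
      inner_add_right, inner_smul_right, inner_self_eq_norm_sq_to_K, h1, inner_smul_left,
      inner_zeroExtend_normalExtend hdn, inner_normalExtend_zeroExtend hdn, Complex.conj_I]
    simp only [RCLike.ofReal_one, one_pow, mul_zero, zero_smul, add_zero, zero_add, mul_one]
    module

end NormalBundle

/-! ### Oriented frames and rotations -/

theorem IsOrthonormalFrame.metric_self {d n : ℕ} {hdn : d < n} {x : CP d}
    {f : CSp (n - d) →L[ℝ] Op n} (hf : IsOrthonormalFrame hdn x f) (v : CSp (n - d)) :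
    metric n (f v) (f v) = ‖v‖ ^ 2 := by
  rw [hf.2, ← inner_real_eq, real_inner_self_eq_norm_sq]

theorem IsOrthonormalFrame.injective {d n : ℕ} {hdn : d < n} {x : CP d}
    {f : CSp (n - d) →L[ℝ] Op n} (hf : IsOrthonormalFrame hdn x f) : Function.Injective f := by
  rw [injective_iff_map_eq_zero]
  intro v hv
  have h := hf.metric_self v
  rw [hv] at h
  have h0 : metric n (0 : Op n) 0 = 0 := by simp [metric]
  rw [h0] at h
  simpa using h.symm

/-- Two orthonormal frames of the same normal space differ by an isometry. -/
theorem IsOrthonormalFrame.exists_isometry {d n : ℕ} {hdn : d < n} {x : CP d}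
    {f f' : CSp (n - d) →L[ℝ] Op n} (hf : IsOrthonormalFrame hdn x f)
    (hf' : IsOrthonormalFrame hdn x f') :
    ∃ B : CSp (n - d) ≃ₗᵢ[ℝ] CSp (n - d), ∀ v, f v = f' (B v) := by
  have hr : ∀ v, ∃ w, f' w = f v := fun v => by
    have h : f v ∈ (f : CSp (n - d) →ₗ[ℝ] Op n).range := ⟨v, rfl⟩
    rwa [hf.1, ← hf'.1] at h
  choose b hb using hr
  have hn : ∀ v, ‖b v‖ = ‖v‖ := fun v => by
    have h := hf'.metric_self (b v)
    rw [hb, hf.metric_self] at h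
    exact ((sq_eq_sq₀ (norm_nonneg _) (norm_nonneg _)).1 h).symm
  let B : CSp (n - d) →ₗᵢ[ℝ] CSp (n - d) :=
    { toFun := b
      map_add' := fun v w => hf'.injective (by rw [hb, map_add, map_add, hb, hb])
      map_smul' := fun a v => hf'.injective (by rw [hb, RingHom.id_apply, map_smul, map_smul, hb])
      norm_map' := hn }
  exact ⟨B.toLinearIsometryEquiv rfl, fun v => (hb v).symm⟩

/-- A complex linear isometry preserves the orientation. -/
theorem det_pos_of_map_I_smul {k : ℕ} (U : CSp k ≃ₗᵢ[ℝ] CSp k)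
    (hU : ∀ v, U (Complex.I • v) = Complex.I • U v) : 0 < LinearMap.det U.toLinearMap := by
  let V : CSp k →ₗ[ℂ] CSp k :=
    { toFun := U
      map_add' := U.map_add
      map_smul' := fun a v => by
        conv_lhs => rw [← Complex.re_add_im a, add_smul, mul_smul, Complex.coe_smul, Complex.coe_smul,
          map_add, U.map_smul, U.map_smul, hU]
        conv_rhs => rw [RingHom.id_apply, ← Complex.re_add_im a, add_smul, mul_smul, Complex.coe_smul,
          Complex.coe_smul] }
  have h : LinearMap.det U.toLinearMap = Complex.normSq (LinearMap.det V) := by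
    rw [← Algebra.norm_complex_apply, ← LinearMap.det_restrictScalars]
    rfl
  have h0 : LinearMap.det U.toLinearMap ≠ 0 := U.toLinearEquiv.isUnit_det'.ne_zero
  rw [h] at h0 ⊢
  exact lt_of_le_of_ne (Complex.normSq_nonneg _) h0.symm

/-- The oriented frames are obtained from the frame of a unit vector by rotations. -/
theorem IsOrientedFrame.exists_rot {d n : ℕ} {hdn : d < n} {x : CP d}
    {f : CSp (n - d) →L[ℝ] Op n} (hf : IsOrientedFrame hdn x f) {z : CSp (d + 1)}
    (hz : z ∈ x.submodule) (hz1 : ‖z‖ = 1) :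
    ∃ g : Spin (n - d), ∀ v, f v = normalFrame d n z (rot g v) := by
  obtain ⟨hf1, u, ⟨hu1, hu2⟩, A, hA, hfA⟩ := hf
  obtain ⟨hs1, hs2⟩ := isUnitaryFrame_normalFrame hdn hz hz1
  obtain ⟨U, hU⟩ := hu1.exists_isometry hs1
  obtain ⟨φ, hφ⟩ := hf1.exists_isometry hs1
  have h1 : 0 < LinearMap.det U.toLinearMap := det_pos_of_map_I_smul U fun v =>
    hs1.injective (by rw [← hU, hu2, hs2, hU])
  have h2 : φ.toLinearMap = U.toLinearMap ∘ₗ A := by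
    ext1 v
    exact hs1.injective (by
      change normalFrame d n z (φ v) = normalFrame d n z (U (A v))
      rw [← hφ, ← hU, hfA])
  have h3 : 0 < LinearMap.det φ.toLinearMap := by
    rw [h2, LinearMap.det_comp]
    exact mul_pos h1 hA
  obtain ⟨_, _, _, _, g, _, hg⟩ := exists_vecProd_of_det_pos φ h3
  exact ⟨g, fun v => by rw [hg, hφ]⟩

theorem isOrientedFrame_normalFrame_rot {d n : ℕ} (hdn : d < n) {x : CP d} {z : CSp (d + 1)}
    (hz : z ∈ x.submodule) (hz1 : ‖z‖ = 1) (g : Spin (n - d)) :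
    IsOrientedFrame hdn x (normalFrame d n z ∘L rotCLM g) := by
  have hu := isUnitaryFrame_normalFrame hdn hz hz1
  refine ⟨⟨?_, fun v w => ?_⟩, _, hu, rot g, det_rot_pos g, fun v => rfl⟩
  · rw [← hu.1.1]
    ext X
    constructor
    · rintro ⟨v, rfl⟩
      exact ⟨rot g v, rfl⟩
    · rintro ⟨v, rfl⟩
      refine ⟨rot g⁻¹ v, ?_⟩
      change normalFrame d n z (rot g (rot g⁻¹ v)) = normalFrame d n z v
      rw [← rot_mul, mul_inv_cancel, rot_one]
  · change metric n (normalFrame d n z (rot g v)) (normalFrame d n z (rot g w)) = _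
    rw [hu.1.2, ← inner_real_eq, inner_rot, inner_real_eq]

/-- The unit sphere of `ℂᵈ⁺¹`, the total space of the frame bundle of `γ_d`. -/
abbrev Sph (d : ℕ) : Type := Metric.sphere (0 : CSp (d + 1)) 1

theorem Sph.norm_eq {d : ℕ} (z : Sph d) : ‖(z : CSp (d + 1))‖ = 1 := mem_sphere_zero_iff_norm.1 z.2

/-- The line spanned by a unit vector. -/
def Sph.line {d : ℕ} (z : Sph d) : CP d :=
  Projectivization.mk ℂ (z : CSp (d + 1)) (ne_zero_of_norm_eq_one z.norm_eq)

theorem Sph.mem_line {d : ℕ} (z : Sph d) : (z : CSp (d + 1)) ∈ z.line.submodule := by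
  rw [Sph.line, Projectivization.submodule_mk]
  exact Submodule.mem_span_singleton_self _

theorem Sph.line_eq {d : ℕ} (z : Sph d) {x : CP d} (hz : (z : CSp (d + 1)) ∈ x.submodule) :
    z.line = x := (eq_mk_of_mem hz (ne_zero_of_norm_eq_one z.norm_eq)).symm

theorem Sph.exists_line_eq {d : ℕ} (x : CP d) : ∃ z : Sph d, z.line = x := by
  obtain ⟨z, hz, hz1⟩ := exists_unit_mem x
  exact ⟨⟨z, mem_sphere_zero_iff_norm.2 hz1⟩, Sph.line_eq _ hz⟩

instance (d : ℕ) : MulAction Circle (Sph d) where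
  smul u z := ⟨u • (z : CSp (d + 1)), by
    rw [mem_sphere_zero_iff_norm, Circle.smul_def, norm_smul, Circle.norm_coe, one_mul, z.norm_eq]⟩
  one_smul z := Subtype.ext (one_smul Circle (z : CSp (d + 1)))
  mul_smul u v z := Subtype.ext (mul_smul u v (z : CSp (d + 1)))

theorem Sph.coe_smul {d : ℕ} (u : Circle) (z : Sph d) :
    ((u • z : Sph d) : CSp (d + 1)) = u • (z : CSp (d + 1)) := rfl

instance (d : ℕ) : ContinuousSMul Circle (Sph d) where
  continuous_smul := Continuous.subtype_mk
    (continuous_fst.smul (continuous_subtype_val.comp continuous_snd)) _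

theorem Sph.line_smul {d : ℕ} (u : Circle) (z : Sph d) : (u • z).line = z.line :=
  Sph.line_eq _ (by
    rw [Sph.coe_smul, Circle.smul_def]
    exact Submodule.smul_mem _ _ z.mem_line)

theorem Sph.line_eq_line_iff {d : ℕ} {z w : Sph d} : z.line = w.line ↔ ∃ u : Circle, z = u • w := by
  constructor
  · intro h
    have hz : (z : CSp (d + 1)) ∈ w.line.submodule := h ▸ z.mem_line
    rw [Sph.line, Projectivization.submodule_mk, Submodule.mem_span_singleton] at hz
    obtain ⟨a, ha⟩ := hz
    have ha1 : ‖a‖ = 1 := by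
      have := congrArg norm ha
      rwa [norm_smul, w.norm_eq, z.norm_eq, mul_one] at this
    exact ⟨⟨a, mem_sphere_zero_iff_norm.2 ha1⟩, Subtype.ext ha.symm⟩
  · rintro ⟨u, rfl⟩
    exact Sph.line_smul u w

theorem Sph.eq_one_of_smul_eq {d : ℕ} {u : Circle} {z : Sph d} (h : u • z = z) : u = 1 := by
  have h1 := congrArg (Subtype.val : Sph d → CSp (d + 1)) h
  rw [Sph.coe_smul, Circle.smul_def] at h1
  have h2 : ((u : ℂ) - 1) • (z : CSp (d + 1)) = 0 := by rw [sub_smul, h1, one_smul, sub_self]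
  rcases smul_eq_zero.1 h2 with h3 | h3
  · exact Circle.ext (sub_eq_zero.1 h3)
  · exact absurd h3 (ne_zero_of_norm_eq_one z.norm_eq)

/-- The oriented frame obtained by rotating the frame of the unit vector `z` by `g`. -/
def rotFrame {d n : ℕ} (hdn : d < n) (z : Sph d) (g : Spin (n - d)) : SOFrame hdn :=
  ⟨(z.line, normalFrame d n (z : CSp (d + 1)) ∘L rotCLM g),
    isOrientedFrame_normalFrame_rot hdn z.mem_line z.norm_eq g⟩

theorem SOFrame.ext_iff' {d n : ℕ} {hdn : d < n} {F G : SOFrame hdn} :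
    F = G ↔ F.1.1 = G.1.1 ∧ ∀ v, F.1.2 v = G.1.2 v :=
  ⟨fun h => h ▸ ⟨rfl, fun _ => rfl⟩,
    fun h => Subtype.ext (Prod.ext h.1 (ContinuousLinearMap.ext h.2))⟩

theorem rotFrame_apply {d n : ℕ} (hdn : d < n) (z : Sph d) (g : Spin (n - d)) (v : CSp (n - d)) :
    (rotFrame hdn z g).1.2 v = normalFrame d n (z : CSp (d + 1)) (rot g v) := rfl

theorem rotFrame_base {d n : ℕ} (hdn : d < n) (z : Sph d) (g : Spin (n - d)) :
    (rotFrame hdn z g).1.1 = z.line := rfl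

theorem exists_rotFrame_eq {d n : ℕ} {hdn : d < n} (F : SOFrame hdn) {z : Sph d}
    (hz : z.line = F.1.1) : ∃ g, rotFrame hdn z g = F := by
  obtain ⟨g, hg⟩ := F.2.exists_rot (z := z) (hz ▸ z.mem_line) z.norm_eq
  exact ⟨g, SOFrame.ext_iff'.2 ⟨hz, fun v => (hg v).symm⟩⟩

theorem rotFrame_smul {d n : ℕ} (hdn : d < n) (u : Circle) (z : Sph d) (g : Spin (n - d)) :
    rotFrame hdn (u • z) g = rotFrame hdn z (circleLift (n - d) u * g) := by
  refine SOFrame.ext_iff'.2 ⟨Sph.line_smul u z, fun v => ?_⟩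
  rw [rotFrame_apply, rotFrame_apply, Sph.coe_smul, normalFrame_smul, rot_mul, rot_circleLift]

theorem rotFrame_inj {d n : ℕ} {hdn : d < n} {z : Sph d} {g h : Spin (n - d)}
    (H : rotFrame hdn z g = rotFrame hdn z h) : (g : Cl (n - d)) = h ∨ (g : Cl (n - d)) = -h := by
  refine eq_or_eq_neg_of_rot_eq fun v => ?_
  exact (isUnitaryFrame_normalFrame hdn z.mem_line z.norm_eq).1.injective
    ((SOFrame.ext_iff'.1 H).2 v)

theorem continuous_pos_line {d n : ℕ} (hdn : d < n) : Continuous fun z : Sph d => pos hdn z.line := by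
  have h : (fun z : Sph d => pos hdn z.line) = fun z : Sph d =>
      InnerProductSpace.rankOne ℂ (zeroExtend d n z) (zeroExtend d n z) :=
    funext fun z => pos_eq_rankOne hdn z.mem_line z.norm_eq
  rw [h]
  have h1 : Continuous fun z : Sph d => zeroExtend d n z :=
    (LinearMap.continuous_of_finiteDimensional (zeroExtend d n)).comp continuous_subtype_val
  refine continuous_clm_apply.2 fun y => ?_
  simp only [InnerProductSpace.rankOne_apply]
  exact (h1.inner (𝕜 := ℂ) continuous_const).smul h1

theorem continuous_rotFrame {d n : ℕ} (hdn : d < n) :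
    Continuous fun q : Sph d × Spin (n - d) => rotFrame hdn q.1 q.2 := by
  refine continuous_induced_rng.2 (Continuous.prodMk ((continuous_pos_line hdn).comp continuous_fst) ?_)
  exact ((normalFrame d n).continuous.comp (continuous_subtype_val.comp continuous_fst)).clm_comp
    ((continuous_rotCLM _).comp continuous_snd)

instance {d n : ℕ} (hdn : d < n) : T2Space (SOFrame hdn) :=
  T2Space.of_injective_continuous (f := fun F : SOFrame hdn => (pos hdn F.1.1, F.1.2))
    (fun _ _ h => Subtype.ext (Prod.ext (pos_injective hdn (Prod.ext_iff.1 h).1) (Prod.ext_iff.1 h).2))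
    continuous_induced_dom

/-! ### Existence of a spin structure -/

/-- The trivial `Spin`-bundle over the sphere. As a type of its own it carries the action of the circle
on both factors. -/
def PreSpin (d k : ℕ) : Type := Sph d × Spin k

instance (d k : ℕ) : TopologicalSpace (PreSpin d k) := inferInstanceAs (TopologicalSpace (Sph d × Spin k))

instance (d k : ℕ) : T2Space (PreSpin d k) := inferInstanceAs (T2Space (Sph d × Spin k))

/-- The action of the circle by `u (z, g) = (u z, λ(u)⁻¹ g)`, where `λ` is the lift of `u ↦ u⁻¹ id`. -/
instance (d k : ℕ) [hk : Fact (Even k)] : MulAction Circle (PreSpin d k) where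
  smul u q := (u • q.1, circleLift k u⁻¹ * q.2)
  one_smul q := Prod.ext (one_smul Circle q.1) (by
    change circleLift k 1⁻¹ * q.2 = q.2
    rw [inv_one, circleLift_one hk.1, one_mul])
  mul_smul u v q := Prod.ext (mul_smul u v q.1) (by
    change circleLift k (u * v)⁻¹ * q.2 = circleLift k u⁻¹ * (circleLift k v⁻¹ * q.2)
    rw [mul_inv, circleLift_mul hk.1, mul_assoc])

instance (d k : ℕ) [hk : Fact (Even k)] : ContinuousSMul Circle (PreSpin d k) where
  continuous_smul := by
    have h1 : Continuous fun q : Circle × PreSpin d k => q.2.1 := continuous_fst.comp continuous_snd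
    have h2 : Continuous fun q : Circle × PreSpin d k => q.2.2 := continuous_snd.comp continuous_snd
    have h3 : Continuous fun q : Circle × PreSpin d k => circleLift k q.1⁻¹ :=
      (continuous_circleLift hk.1).comp continuous_fst.inv
    exact (continuous_fst.smul h1).prodMk (h3.mul h2)

theorem compactSpace_preSpin (d : ℕ) {k : ℕ} (hk : 0 < k) : CompactSpace (PreSpin d k) := by
  have := compactSpace_spin hk
  exact inferInstanceAs (CompactSpace (Sph d × Spin k))

/-- The total space `S²ᵈ⁺¹ ×_{U₁} Spin₂ₖ` of the spin structure. -/
def SpinTotal (d k : ℕ) [Fact (Even k)] : Type := Quotient (MulAction.orbitRel Circle (PreSpin d k))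

namespace SpinTotal

variable {d k : ℕ} [hk : Fact (Even k)]

instance : TopologicalSpace (SpinTotal d k) :=
  inferInstanceAs (TopologicalSpace (Quotient (MulAction.orbitRel Circle (PreSpin d k))))

/-- The class of `(z, g)`. -/
def mk (z : Sph d) (g : Spin k) : SpinTotal d k :=
  Quotient.mk (MulAction.orbitRel Circle (PreSpin d k)) (z, g)

theorem isOpenQuotientMap_mk :
    IsOpenQuotientMap fun q : Sph d × Spin k => (mk q.1 q.2 : SpinTotal d k) :=
  MulAction.isOpenQuotientMap_quotientMk (Γ := Circle) (T := PreSpin d k)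

theorem mk_eq_mk_iff {z w : Sph d} {g h : Spin k} :
    (mk z g : SpinTotal d k) = mk w h ↔ ∃ u : Circle, z = u • w ∧ g = circleLift k u⁻¹ * h := by
  refine (Quotient.eq (r := MulAction.orbitRel Circle (PreSpin d k))).trans ?_
  exact exists_congr fun u => ⟨fun h => ⟨(Prod.ext_iff.1 h.symm).1, (Prod.ext_iff.1 h.symm).2⟩,
    fun h => (Prod.ext h.1 h.2).symm⟩

theorem mk_smul (u : Circle) (z : Sph d) (g : Spin k) :
    (mk (u • z) g : SpinTotal d k) = mk z (circleLift k u * g) :=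
  mk_eq_mk_iff.2 ⟨u, rfl, by
    rw [← mul_assoc, ← circleLift_mul hk.1, inv_mul_cancel, circleLift_one hk.1, one_mul]⟩

theorem mk_right_injective {z : Sph d} {g h : Spin k} (H : (mk z g : SpinTotal d k) = mk z h) :
    g = h := by
  obtain ⟨u, h1, h2⟩ := mk_eq_mk_iff.1 H
  rw [h2, Sph.eq_one_of_smul_eq h1.symm, inv_one, circleLift_one hk.1, one_mul]

theorem ind {C : SpinTotal d k → Prop} (h : ∀ z g, C (mk z g)) (p : SpinTotal d k) : C p :=
  Quotient.inductionOn p fun q => h q.1 q.2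

/-- The right action of the spin group. -/
def act (p : SpinTotal d k) (g : Spin k) : SpinTotal d k :=
  Quotient.lift (fun q : PreSpin d k => mk q.1 (q.2 * g)) (by
    rintro _ q ⟨u, rfl⟩
    exact mk_eq_mk_iff.2 ⟨u, rfl, mul_assoc _ _ _⟩) p

theorem act_mk (z : Sph d) (g h : Spin k) : act (mk z g) h = mk z (g * h) := rfl

theorem continuous_act : Continuous fun q : SpinTotal d k × Spin k => act q.1 q.2 := by
  have h := (isOpenQuotientMap_mk (d := d) (k := k)).prodMap (IsOpenQuotientMap.id (X := Spin k))
  rw [h.isQuotientMap.continuous_iff]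
  exact isOpenQuotientMap_mk.continuous.comp
    ((continuous_fst.comp continuous_fst).prodMk ((continuous_snd.comp continuous_fst).mul continuous_snd))

theorem act_one (p : SpinTotal d k) : act p 1 = p := by
  induction p using ind with
  | h z g => rw [act_mk, mul_one]

theorem act_mul (p : SpinTotal d k) (g h : Spin k) : act p (g * h) = act (act p g) h := by
  induction p using ind with
  | h z f => rw [act_mk, act_mk, act_mk, mul_assoc]

theorem act_injective (p : SpinTotal d k) : Function.Injective (act p) := by
  induction p using ind with
  | h z f => exact fun g h H => mul_left_cancel (mk_right_injective H)

theorem compactSpace (hk0 : 0 < k) : CompactSpace (SpinTotal d k) :=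
  have := compactSpace_preSpin d hk0
  inferInstanceAs (CompactSpace (Quotient (MulAction.orbitRel Circle (PreSpin d k))))

theorem t2Space (hk0 : 0 < k) : T2Space (SpinTotal d k) := by
  have := compactSpace_preSpin d hk0
  have : ProperSMul Circle (PreSpin d k) :=
    ⟨((continuous_fst.smul continuous_snd).prodMk continuous_snd).isProperMap⟩
  exact inferInstanceAs (T2Space (Quotient (MulAction.orbitRel Circle (PreSpin d k))))

end SpinTotal

/-- The signs as elements of the spin group. -/
def signSpin {k : ℕ} (hk : 0 < k) : ℤˣ →* Spin k where
  toFun ε := ⟨((ε : ℤ) : Cl k), by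
    rcases Int.units_eq_one_or ε with rfl | rfl
    · simp
    · simpa using neg_one_mem_spinGroup hk⟩
  map_one' := Subtype.ext (by simp)
  map_mul' ε δ := Subtype.ext (by simp)

theorem coe_signSpin {k : ℕ} (hk : 0 < k) (ε : ℤˣ) : (signSpin hk ε : Cl k) = ((ε : ℤ) : Cl k) := rfl

theorem signSpin_injective {k : ℕ} (hk : 0 < k) : Function.Injective (signSpin hk) := by
  intro ε δ h
  have h1 : ((ε : ℤ) : Cl k) = ((δ : ℤ) : Cl k) := congrArg Subtype.val h
  rw [← map_intCast (algebraMap ℝ (Cl k)), ← map_intCast (algebraMap ℝ (Cl k))] at h1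
  exact Units.ext (Int.cast_injective ((algebraMap ℝ (Cl k)).injective h1))

theorem rot_signSpin {k : ℕ} (hk : 0 < k) (ε : ℤˣ) (v : CSp k) : rot (signSpin hk ε) v = v :=
  rot_eq_of_mul_eq (by rw [coe_signSpin]; exact (Int.cast_commute _ _).eq)

section Frame

variable {d n : ℕ} (hdn : d < n) [hk : Fact (Even (n - d))]

/-- The projection to the oriented frame bundle, `[z, g] ↦ rotFrame z g`. -/
def SpinTotal.toFrame (p : SpinTotal d (n - d)) : SOFrame hdn :=
  Quotient.lift (fun q : PreSpin d (n - d) => rotFrame hdn q.1 q.2) (by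
    rintro _ q ⟨u, rfl⟩
    change rotFrame hdn (u • q.1) (circleLift _ u⁻¹ * q.2) = rotFrame hdn q.1 q.2
    rw [rotFrame_smul, ← mul_assoc, ← circleLift_mul hk.1, mul_inv_cancel, circleLift_one hk.1,
      one_mul]) p

theorem SpinTotal.toFrame_mk (z : Sph d) (g : Spin (n - d)) :
    SpinTotal.toFrame hdn (SpinTotal.mk z g) = rotFrame hdn z g := rfl

theorem SpinTotal.toFrame_act (p : SpinTotal d (n - d)) (g : Spin (n - d)) :
    (SpinTotal.toFrame hdn (p.act g)).1.1 = (SpinTotal.toFrame hdn p).1.1 ∧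
      ∀ v, (SpinTotal.toFrame hdn (p.act g)).1.2 v = (SpinTotal.toFrame hdn p).1.2 (rot g v) := by
  induction p using SpinTotal.ind with
  | h z f =>
    rw [SpinTotal.act_mk, SpinTotal.toFrame_mk, SpinTotal.toFrame_mk, rotFrame_base, rotFrame_base]
    refine ⟨rfl, fun v => ?_⟩
    rw [rotFrame_apply, rotFrame_apply, rot_mul]

theorem SpinTotal.exists_mk_eq (p : SpinTotal d (n - d)) {z : Sph d}
    (hz : z.line = (SpinTotal.toFrame hdn p).1.1) : ∃ g, p = SpinTotal.mk z g := by
  induction p using SpinTotal.ind with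
  | h w g =>
    rw [SpinTotal.toFrame_mk, rotFrame_base] at hz
    obtain ⟨u, rfl⟩ := Sph.line_eq_line_iff.1 hz.symm
    exact ⟨_, SpinTotal.mk_smul u z g⟩

theorem SpinTotal.continuous_toFrame : Continuous (SpinTotal.toFrame hdn) := by
  rw [SpinTotal.isOpenQuotientMap_mk.isQuotientMap.continuous_iff]
  exact continuous_rotFrame hdn

theorem SpinTotal.surjective_toFrame : Function.Surjective (SpinTotal.toFrame hdn) := fun F => by
  obtain ⟨z, hz⟩ := Sph.exists_line_eq F.1.1
  obtain ⟨g, hg⟩ := exists_rotFrame_eq F hz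
  exact ⟨SpinTotal.mk z g, hg⟩

/-- The fibres of the projection to the frame bundle are the orbits of the free action of `{1, -1}`, and
it is a quotient map as a surjective map from a compact space to a Hausdorff space. -/
theorem SpinTotal.isCoveringMap_toFrame : IsCoveringMap (SpinTotal.toFrame hdn) := by
  have hk0 : 0 < n - d := by omega
  have := SpinTotal.compactSpace (d := d) hk0
  have := SpinTotal.t2Space (d := d) hk0
  let : MulAction ℤˣ (SpinTotal d (n - d)) :=
    { smul := fun ε p => p.act (signSpin hk0 ε)
      one_smul := fun p => by
        change p.act (signSpin hk0 1) = p
        rw [map_one, SpinTotal.act_one]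
      mul_smul := fun ε δ p => by
        change p.act (signSpin hk0 (ε * δ)) = (p.act (signSpin hk0 δ)).act (signSpin hk0 ε)
        rw [mul_comm, map_mul, SpinTotal.act_mul] }
  have hsmul : ∀ (ε : ℤˣ) (p : SpinTotal d (n - d)), ε • p = p.act (signSpin hk0 ε) :=
    fun _ _ => rfl
  have : ContinuousConstSMul ℤˣ (SpinTotal d (n - d)) :=
    ⟨fun ε => SpinTotal.continuous_act.comp (continuous_id.prodMk continuous_const)⟩
  have : IsCancelSMul ℤˣ (SpinTotal d (n - d)) :=
    ⟨fun ε δ p h => signSpin_injective hk0 (p.act_injective h)⟩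
  have hq : Topology.IsQuotientMap (SpinTotal.toFrame hdn) :=
    (SpinTotal.continuous_toFrame hdn).isClosedMap.isQuotientMap
      (SpinTotal.continuous_toFrame hdn) (SpinTotal.surjective_toFrame hdn)
  refine (hq.isQuotientCoveringMap_of_properlyDiscontinuousSMul (G := ℤˣ) ?_).isCoveringMap
  intro p q
  constructor
  · intro h
    induction q using SpinTotal.ind with
    | h z g =>
      obtain ⟨f, rfl⟩ := SpinTotal.exists_mk_eq hdn p (z := z)
        (by rw [h, SpinTotal.toFrame_mk, rotFrame_base])
      rw [SpinTotal.toFrame_mk, SpinTotal.toFrame_mk] at h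
      rcases rotFrame_inj h with h | h
      · exact ⟨1, by
          change (1 : ℤˣ) • SpinTotal.mk z g = _
          rw [one_smul, Subtype.ext h]⟩
      · refine ⟨-1, ?_⟩
        change SpinTotal.mk z (g * signSpin hk0 (-1)) = _
        congr 1
        refine Subtype.ext ?_
        rw [h, Submonoid.coe_mul, coe_signSpin]
        simp
  · rintro ⟨ε, rfl⟩
    refine SOFrame.ext_iff'.2 ⟨(SpinTotal.toFrame_act hdn q _).1, fun v => ?_⟩
    change (SpinTotal.toFrame hdn (q.act (signSpin hk0 ε))).1.2 v = _
    rw [(SpinTotal.toFrame_act hdn q _).2, rot_signSpin]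

/-- The spin structure `S²ᵈ⁺¹ ×_{U₁} Spin₂ₖ` of the normal bundle, for even `k = n - d`. -/
def stdSpinStructure : SpinStructure.{0} hdn where
  P := SpinTotal d (n - d)
  act := SpinTotal.act
  toFrame := SpinTotal.toFrame hdn
  act_one := SpinTotal.act_one
  act_mul := SpinTotal.act_mul
  continuous_act := SpinTotal.continuous_act
  simply_transitive p q h := by
    induction p using SpinTotal.ind with
    | h z f =>
      rw [SpinTotal.toFrame_mk, rotFrame_base] at h
      obtain ⟨g, rfl⟩ := SpinTotal.exists_mk_eq hdn q (z := z) h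
      refine ⟨f⁻¹ * g, ?_, fun g' hg' => ?_⟩
      · change _ = SpinTotal.mk z (f * (f⁻¹ * g))
        rw [mul_inv_cancel_left]
      · refine SpinTotal.act_injective (SpinTotal.mk z f) (hg'.symm.trans ?_)
        rw [SpinTotal.act_mk, mul_inv_cancel_left]
  covering := SpinTotal.isCoveringMap_toFrame hdn
  surjective := SpinTotal.surjective_toFrame hdn
  base_act p g := (SpinTotal.toFrame_act hdn p g).1
  frame_act p g v w h := by
    rw [(SpinTotal.toFrame_act hdn p g).2]
    congr 1
    refine ι_injective _ ?_
    rw [h, ι_rot]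
    rfl

end Frame

/-! ### Lifting maps of spheres through coverings -/

section Lift

variable {V : Type*} [NormedAddCommGroup V] [InnerProductSpace ℝ V]
  {E X : Type*} [TopologicalSpace E] [TopologicalSpace X] {p : E → X}

theorem eq_zero_of_eq_neg_self {v : V} (h : v = -v) : v = 0 := by
  have h1 : (2 : ℝ) • v = 0 := by rw [two_smul, ← eq_neg_iff_add_eq_zero]; exact h
  exact (smul_eq_zero.1 h1).resolve_left two_ne_zero

/-- Maps of a punctured sphere lift through coverings, as stereographic projection identifies it with
a vector space. -/
theorem exists_lift_compl_singleton (hp : IsCoveringMap p)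
    {f : Metric.sphere (0 : V) 1 → X} (hf : Continuous f) (v : Metric.sphere (0 : V) 1)
    {x₀ : Metric.sphere (0 : V) 1} (hx₀ : x₀ ≠ v) {e₀ : E} (he₀ : p e₀ = f x₀) :
    ∃ F : Metric.sphere (0 : V) 1 → E, ContinuousOn F {v}ᶜ ∧ F x₀ = e₀ ∧
      ∀ x, x ≠ v → p (F x) = f x := by
  have hv : ‖(v : V)‖ = 1 := mem_sphere_zero_iff_norm.1 v.2
  have hsource : (stereographic hv).source = {v}ᶜ := stereographic_source hv
  have hσ : Continuous (stereographic hv).symm := by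
    rw [← continuousOn_univ, ← stereographic_target hv]
    exact (stereographic hv).continuousOn_symm
  have hinv : ∀ x, x ≠ v → (stereographic hv).symm (stereographic hv x) = x := fun x hx =>
    (stereographic hv).left_inv (hsource ▸ hx)
  obtain ⟨G, ⟨hG0, hG⟩, _⟩ := hp.existsUnique_continuousMap_lifts
    ⟨f ∘ (stereographic hv).symm, hf.comp hσ⟩ (stereographic hv x₀) e₀
    (by rw [he₀, ContinuousMap.coe_mk, Function.comp_apply, hinv x₀ hx₀])
  refine ⟨G ∘ stereographic hv, G.continuous.comp_continuousOn (hsource ▸ (stereographic hv).continuousOn),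
    hG0, fun x hx => ?_⟩
  have h := congrFun hG (stereographic hv x)
  simp only [Function.comp_apply, ContinuousMap.coe_mk, hinv x hx] at h
  exact h

theorem isPreconnected_sphere_compl_pair {v : V} (hv : ‖v‖ = 1) (hV : 1 < Module.rank ℝ (ℝ ∙ v)ᗮ) :
    IsPreconnected ({⟨v, by simp [hv]⟩}ᶜ ∩ {-⟨v, by simp [hv]⟩}ᶜ : Set (Metric.sphere (0 : V) 1)) := by
  have h := (isConnected_compl_singleton_of_one_lt_rank hV (0 : (ℝ ∙ v)ᗮ)).isPreconnected
  have hσ : Continuous (stereographic hv).symm := by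
    rw [← continuousOn_univ, ← stereographic_target hv]
    exact (stereographic hv).continuousOn_symm
  have h0 : stereographic hv (-⟨v, by simp [hv]⟩) = 0 := stereographic_apply_neg ⟨v, by simp [hv]⟩
  convert h.image _ hσ.continuousOn using 1
  ext x
  rw [← stereographic_source hv, ← (stereographic hv).symm_image_target_eq_source,
    stereographic_target]
  constructor
  · rintro ⟨⟨a, -, rfl⟩, ha⟩
    refine ⟨a, fun ha0 => ha ?_, rfl⟩
    have h1 : (-⟨v, by simp [hv]⟩ : Metric.sphere (0 : V) 1) ∈ (stereographic hv).source := by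
      rw [stereographic_source]
      intro h
      have h2 := congrArg (Subtype.val : Metric.sphere (0 : V) 1 → V) h
      have h3 : v = 0 := eq_zero_of_eq_neg_self (V := V) h2.symm
      rw [h3, norm_zero] at hv
      exact zero_ne_one hv
    rw [Set.mem_singleton_iff.1 ha0, ← h0]
    exact (stereographic hv).left_inv h1
  · rintro ⟨a, ha, rfl⟩
    refine ⟨⟨a, Set.mem_univ _, rfl⟩, fun h1 => ha ?_⟩
    have h2 := congrArg (stereographic hv) (Set.mem_singleton_iff.1 h1)
    rw [h0, (stereographic hv).right_inv (by rw [stereographic_target]; exact Set.mem_univ _)] at h2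
    exact h2

/-- Maps of spheres of dimension at least two lift through coverings. The lifts over the complements of
two antipodal points agree on the intersection, which is connected. -/
theorem exists_lift_sphere [FiniteDimensional ℝ V] (hV : 2 < Module.finrank ℝ V) (hp : IsCoveringMap p)
    (hsurj : Function.Surjective p) {f : Metric.sphere (0 : V) 1 → X} (hf : Continuous f) :
    ∃ F : Metric.sphere (0 : V) 1 → E, Continuous F ∧ ∀ x, p (F x) = f x := by
  have : Nontrivial V := Module.nontrivial_of_finrank_pos (R := ℝ) (by omega)
  obtain ⟨v, hv⟩ := exists_norm_eq V zero_le_one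
  have hv0 : v ≠ 0 := by rintro rfl; simp at hv
  have hr : 1 < Module.finrank ℝ (ℝ ∙ v)ᗮ := by
    have h1 := (ℝ ∙ v).finrank_add_finrank_orthogonal
    rw [finrank_span_singleton hv0] at h1
    omega
  have hr' : 1 < Module.rank ℝ (ℝ ∙ v)ᗮ := by
    rw [← Module.finrank_eq_rank]
    exact_mod_cast hr
  have hW := isPreconnected_sphere_compl_pair hv hr'
  let a : Metric.sphere (0 : V) 1 := ⟨v, by simp [hv]⟩
  have haa : a ≠ -a := fun h => hv0 (eq_zero_of_eq_neg_self (V := V) (congrArg Subtype.val h))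
  -- a base point different from the two poles
  have : Nontrivial (ℝ ∙ v)ᗮ := Module.nontrivial_of_finrank_pos (R := ℝ) (by omega)
  obtain ⟨⟨w, hw⟩, hw1⟩ := exists_norm_eq (ℝ ∙ v)ᗮ zero_le_one
  have hvw : inner ℝ v w = 0 := Submodule.mem_orthogonal_singleton_iff_inner_right.1 hw
  have hww : inner ℝ w w = (1 : ℝ) := by
    rw [real_inner_self_eq_norm_sq, show ‖w‖ = 1 from hw1, one_pow]
  let x₀ : Metric.sphere (0 : V) 1 := ⟨w, mem_sphere_zero_iff_norm.2 hw1⟩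
  have hx1 : x₀ ≠ a := fun h => by
    have h1 : w = v := congrArg Subtype.val h
    rw [← h1, hww] at hvw
    exact one_ne_zero hvw
  have hx2 : x₀ ≠ -a := fun h => by
    have h1 : w = -v := congrArg Subtype.val h
    have h2 : v = -w := by rw [h1, neg_neg]
    rw [h2, inner_neg_left, hww] at hvw
    norm_num at hvw
  obtain ⟨e₀, he₀⟩ := hsurj (f x₀)
  obtain ⟨F, hF, hF0, hF1⟩ := exists_lift_compl_singleton hp hf a hx1 he₀
  obtain ⟨G, hG, hG0, hG1⟩ := exists_lift_compl_singleton hp hf (-a) hx2 he₀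
  have hFG : Set.EqOn F G ({a}ᶜ ∩ {-a}ᶜ) :=
    hp.eqOn_of_comp_eqOn hW (hF.mono Set.inter_subset_left) (hG.mono Set.inter_subset_right)
      (fun x hx => by rw [Function.comp_apply, Function.comp_apply, hF1 x hx.1, hG1 x hx.2])
      (a := x₀) ⟨hx1, hx2⟩ (by rw [hF0, hG0])
  classical
  refine ⟨fun x => if x = a then G x else F x, ?_, fun x => ?_⟩
  · rw [continuous_iff_continuousAt]
    intro x
    by_cases hx : x = a
    · have h1 : {-a}ᶜ ∈ nhds x := isOpen_compl_singleton.mem_nhds (by rw [hx]; exact haa)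
      refine (hG.continuousAt h1).congr ?_
      filter_upwards [h1] with y hy
      split_ifs with h
      · rfl
      · exact (hFG ⟨h, hy⟩).symm
    · have h1 : {a}ᶜ ∈ nhds x := isOpen_compl_singleton.mem_nhds hx
      refine (hF.continuousAt h1).congr ?_
      filter_upwards [h1] with y hy
      exact (if_neg hy).symm
  · dsimp only
    split_ifs with h
    · exact hG1 x (h ▸ haa)
    · exact hF1 x h

end Lift

/-! ### The lift of the unit sphere to a spin structure -/

section SphereLift

variable {d n : ℕ} {hdn : d < n} (S : SpinStructure.{u} hdn)

theorem SpinStructure.toFrame_act (p : S.P) (g : Spin (n - d)) (v : CSp (n - d)) :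
    (S.toFrame (S.act p g)).1.2 v = (S.toFrame p).1.2 (rot g v) :=
  S.frame_act p g v _ (ι_rot g v)

theorem SpinStructure.toFrame_act_eq_rotFrame {p : S.P} {z : Sph d} {h : Spin (n - d)}
    (hp : S.toFrame p = rotFrame hdn z h) (g : Spin (n - d)) :
    S.toFrame (S.act p g) = rotFrame hdn z (h * g) := by
  refine SOFrame.ext_iff'.2 ⟨?_, fun v => ?_⟩
  · rw [S.base_act, hp, rotFrame_base, rotFrame_base]
  · rw [S.toFrame_act, hp, rotFrame_apply, rotFrame_apply, rot_mul]

/-- A continuous lift of the unit sphere to the spin structure, over the frames of unit vectors. -/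
structure SphereLift where
  /-- the lift -/
  lift : Sph d → S.P
  continuous_lift : Continuous lift
  toFrame_lift : ∀ z, S.toFrame (lift z) = rotFrame hdn z 1

theorem SpinStructure.nonempty_sphereLift (hd : 0 < d) : Nonempty (SphereLift S) := by
  have hr : 2 < Module.finrank ℝ (CSp (d + 1)) := by
    rw [← Module.finrank_mul_finrank ℝ ℂ, Complex.finrank_real_complex, finrank_euclideanSpace_fin]
    omega
  have hc : Continuous fun z : Sph d => rotFrame hdn z 1 :=
    (continuous_rotFrame hdn).comp (continuous_id.prodMk continuous_const)
  obtain ⟨j, hj, hj1⟩ := exists_lift_sphere hr S.covering S.surjective hc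
  exact ⟨⟨j, hj, hj1⟩⟩

variable {S}

theorem SphereLift.base_lift (j : SphereLift S) (z : Sph d) : S.base (j.lift z) = z.line := by
  rw [SpinStructure.base, j.toFrame_lift, rotFrame_base]

/-- The lift of the sphere intertwines the action of the circle with the lift of the circle to the
spin group: both sides lift the same loop of frames and agree at `1`. -/
theorem SphereLift.lift_smul (j : SphereLift S) (hk : Even (n - d)) (u : Circle) (z : Sph d) :
    j.lift (u • z) = S.act (j.lift z) (circleLift (n - d) u) := by
  have h1 : Continuous fun θ : ℝ => j.lift (Circle.exp θ • z) :=
    j.continuous_lift.comp (Circle.exp.continuous.smul continuous_const)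
  have h2 : Continuous fun θ : ℝ => S.act (j.lift z) (circleLift (n - d) (Circle.exp θ)) :=
    S.continuous_act.comp (continuous_const.prodMk
      ((continuous_circleLift hk).comp Circle.exp.continuous))
  have h := S.covering.eq_of_comp_eq h1 h2 (funext fun θ => by
    rw [Function.comp_apply, Function.comp_apply, j.toFrame_lift,
      S.toFrame_act_eq_rotFrame (j.toFrame_lift z), rotFrame_smul, mul_one, one_mul]) 0 (by
    simp only [Circle.exp_zero, one_smul, circleLift_one hk, S.act_one])
  have h3 := congrFun h (Complex.arg u)
  rwa [Circle.exp_arg] at h3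

end SphereLift

/-! ### The fibrewise isomorphisms -/

section AssocEval

variable {B P G V : Type*} [Group G] [AddCommGroup V] [Module ℂ V] {π : P → B} {act : P → G → P}
  {ρ : G → V →ₗ[ℂ] V}

/-- The evaluation of the elements of an associated bundle at a point of the principal bundle. -/
def assocEvalMap (π : P → B) (act : P → G → P) (ρ : G → V →ₗ[ℂ] V) {x : B} (p : {p : P // π p = x}) :
    AssocFibre π act ρ x →ₗ[ℂ] V where
  toFun φ := (φ : _ → V) p
  map_add' _ _ := rfl
  map_smul' _ _ := rfl

theorem assocEvalMap_bijective (act_one : ∀ p, act p 1 = p)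
    (act_mul : ∀ p g h, act p (g * h) = act (act p g) h)
    (simply_transitive : ∀ p q, π p = π q → ∃! g, q = act p g)
    (hρ1 : ∀ v, ρ 1 v = v) (hρm : ∀ g h v, ρ (g * h) v = ρ g (ρ h v)) {x : B}
    (p : {p : P // π p = x}) : Function.Bijective (assocEvalMap π act ρ p) := by
  have hex : ∀ q : {p : P // π p = x}, ∃ g, (q : P) = act p g := fun q =>
    (simply_transitive p q (p.2.trans q.2.symm)).exists
  have huniq : ∀ g h : G, act (p : P) g = act p h → π (act (p : P) g) = x → g = h := fun g h hgh hx =>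
    (simply_transitive p (act p g) (p.2.trans hx.symm)).unique rfl hgh
  constructor
  · rw [injective_iff_map_eq_zero]
    intro φ hφ
    refine Subtype.ext (funext fun q => ?_)
    obtain ⟨g, hg⟩ := hex q
    have h : (φ : _ → V) p = ρ g ((φ : _ → V) q) := φ.2 p q g hg
    have h0 : (φ : _ → V) p = 0 := hφ
    calc (φ : _ → V) q = ρ (g⁻¹ * g) ((φ : _ → V) q) := by rw [inv_mul_cancel, hρ1]
      _ = 0 := by rw [hρm, ← h, h0, map_zero]
  · intro v
    choose γ hγ using hex
    refine ⟨⟨fun q => ρ (γ q)⁻¹ v, fun q r g hr => ?_⟩, ?_⟩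
    · dsimp only
      have h : γ r = γ q * g := huniq _ _ (by rw [← hγ r, act_mul, ← hγ q, hr]) (by rw [← hγ r, r.2])
      rw [h, ← hρm, mul_inv_rev, mul_inv_cancel_left]
    · have h : γ p = 1 := huniq _ _ (by rw [← hγ p, act_one]) (by rw [← hγ p, p.2])
      change ρ (γ p)⁻¹ v = v
      rw [h, inv_one, hρ1]

end AssocEval

/-- A unit vector as a frame of `γ_d`. -/
def Sph.frame {d : ℕ} (z : Sph d) : TautFrame d := ⟨(z.line, z), z.mem_line, z.norm_eq⟩

theorem Sph.base_frame {d : ℕ} (z : Sph d) : z.frame.base = z.line := rfl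

theorem TautFrame.ext {d : ℕ} {z w : TautFrame d} (h : z.1.2 = w.1.2) : z = w := by
  have h0 : z.1.2 ≠ 0 := ne_zero_of_norm_eq_one z.2.2
  have h0' : w.1.2 ≠ 0 := ne_zero_of_norm_eq_one w.2.2
  refine Subtype.ext (Prod.ext ?_ h)
  rw [eq_mk_of_mem z.2.1 h0, eq_mk_of_mem w.2.1 h0']
  congr 1

theorem TautFrame.exists_eq_frame {d : ℕ} (z : TautFrame d) : ∃ w : Sph d, z = w.frame :=
  ⟨⟨z.1.2, mem_sphere_zero_iff_norm.2 z.2.2⟩, TautFrame.ext rfl⟩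

theorem Sph.frame_act {d : ℕ} (z : Sph d) (u : Circle) : z.frame.act u = (u • z).frame :=
  TautFrame.ext rfl

theorem TautFrame.simply_transitive {d : ℕ} (z w : TautFrame d) (h : z.base = w.base) :
    ∃! u, w = z.act u := by
  obtain ⟨z, rfl⟩ := z.exists_eq_frame
  obtain ⟨w, rfl⟩ := w.exists_eq_frame
  obtain ⟨u, rfl⟩ := Sph.line_eq_line_iff.1 h.symm
  refine ⟨u, (z.frame_act u).symm, fun v hv => ?_⟩
  dsimp only at hv
  rw [Sph.frame_act] at hv
  have h1 : u • z = v • z := Subtype.ext (congrArg (fun F : TautFrame d => F.1.2) hv)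
  have h2 : (u⁻¹ * v) • z = z := by rw [mul_smul, ← h1, inv_smul_smul]
  exact (inv_mul_eq_one.1 (Sph.eq_one_of_smul_eq h2)).symm

theorem tautPow_eval_bijective {d : ℕ} (m : ℤ) {x : CP d} (z : {z : TautFrame d // z.base = x}) :
    Function.Bijective (assocEvalMap TautFrame.base TautFrame.act (powRep m) z) := by
  refine assocEvalMap_bijective (fun p => TautFrame.ext ?_) (fun p g h => TautFrame.ext ?_)
    TautFrame.simply_transitive (fun v => ?_) (fun g h v => ?_) z
  · simp [TautFrame.act]
  · simp [TautFrame.act, smul_smul, mul_comm]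
  · simp [powRep]
  · simp [powRep, mul_zpow, mul_assoc]

theorem SpinStructure.spinor_eval_bijective {d n : ℕ} {hdn : d < n} (S : SpinStructure.{u} hdn)
    {x : CP d} (p : {p : S.P // S.base p = x}) :
    Function.Bijective (assocEvalMap S.base S.act (spinRep (n - d)) p) :=
  assocEvalMap_bijective S.act_one S.act_mul S.simply_transitive spinRep_one spinRep_mul p

/-- The summands `γ_d^{k/2-s}` correspond to the subsets of `{1, …, k}` with `s` elements. -/
theorem exists_sumIndex_equiv (k : ℕ) :
    ∃ e : SumIndex k ≃ Finset (Fin k), ∀ i, (e i).card = (i.1 : ℕ) := by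
  let f : Finset (Fin k) → Fin (k + 1) := fun S =>
    ⟨S.card, Nat.lt_succ_of_le (by simpa using S.card_le_univ)⟩
  have hc : ∀ s : Fin (k + 1), Fintype.card {S : Finset (Fin k) // f S = s} = k.choose s := fun s => by
    have h : ∀ S : Finset (Fin k), f S = s ↔ S.card = s := fun S => Fin.ext_iff
    simp only [h]
    simp
  refine ⟨(Equiv.sigmaCongrRight fun s => (Fintype.equivFinOfCardEq (hc s)).symm).trans
    (Equiv.sigmaFiberEquiv f), fun i => ?_⟩
  exact Fin.ext_iff.1 ((Fintype.equivFinOfCardEq (hc i.1)).symm i.2).2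

section Isomorphism

variable {d n : ℕ} {hdn : d < n} {S : SpinStructure.{u} hdn}

/-- The components of `F φ` at a unit vector `z` are the coefficients of the spinor `φ` at the lift
of `z`. -/
def SphereLift.IsComponentMap (j : SphereLift S) (e : SumIndex (n - d) ≃ Finset (Fin (n - d)))
    (F : ∀ x : CP d, S.SpinorFibre x ≃ₗ[ℂ] TautSum d (n - d) x) : Prop :=
  ∀ (x : CP d) (φ : S.SpinorFibre x) (i : SumIndex (n - d)) (z : Sph d) (hz : z.line = x),
    (F x φ i).1 ⟨z.frame, hz⟩ = φ.1 ⟨j.lift z, (j.base_lift z).trans hz⟩ (e i)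

/-- Over the unit vector `z`, the spinor `ψ` with coefficients `ψ_S` at the lift of `z` corresponds to
the elements `ψ_S z^{⊗m}` of the powers of `γ_d`. This is independent of `z`, as `z` is replaced by
`u z` when the spin frame is rotated by the lift of `u`, which acts on `ψ_S` by `u^{k/2 - |S|}`. -/
theorem SphereLift.exists_iso (j : SphereLift S) (hk : Even (n - d))
    {e : SumIndex (n - d) ≃ Finset (Fin (n - d))} (he : ∀ i, (e i).card = (i.1 : ℕ)) :
    ∃ F, j.IsComponentMap e F := by
  choose ζ hζ using fun x : CP d => Sph.exists_line_eq x
  let ev : ∀ x : CP d, S.SpinorFibre x ≃ₗ[ℂ] Spinor (n - d) := fun x =>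
    LinearEquiv.ofBijective _
      (S.spinor_eval_bijective ⟨j.lift (ζ x), (j.base_lift (ζ x)).trans (hζ x)⟩)
  let ev' : ∀ (x : CP d) (m : ℤ), TautPow d m x ≃ₗ[ℂ] ℂ := fun x m =>
    LinearEquiv.ofBijective _ (tautPow_eval_bijective m ⟨(ζ x).frame, hζ x⟩)
  refine ⟨fun x => ((ev x).trans ((WithLp.linearEquiv 2 ℂ (Finset (Fin (n - d)) → ℂ)).trans
    (LinearEquiv.funCongrLeft ℂ ℂ e))).trans
      (LinearEquiv.piCongrRight fun i => (ev' x (exponent i)).symm), fun x φ i z hz => ?_⟩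
  obtain ⟨u, rfl⟩ := Sph.line_eq_line_iff.1 (hz.trans (hζ x).symm)
  set h : TautPow d (exponent i) x := (ev' x (exponent i)).symm (ev x φ (e i)) with hh
  change h.1 _ = _
  have h1 : h.1 ⟨(ζ x).frame, hζ x⟩ =
      φ.1 ⟨j.lift (ζ x), (j.base_lift (ζ x)).trans (hζ x)⟩ (e i) :=
    (ev' x (exponent i)).apply_symm_apply (ev x φ (e i))
  have h2 : h.1 ⟨(ζ x).frame, hζ x⟩ = (u : ℂ) ^ exponent i * h.1 ⟨(u • ζ x).frame, hz⟩ :=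
    h.2 ⟨(ζ x).frame, hζ x⟩ ⟨(u • ζ x).frame, hz⟩ u (Sph.frame_act _ u).symm
  have h3 := φ.2 ⟨j.lift (ζ x), (j.base_lift (ζ x)).trans (hζ x)⟩
    ⟨j.lift (u • ζ x), (j.base_lift (u • ζ x)).trans hz⟩ (circleLift (n - d) u) (j.lift_smul hk u (ζ x))
  rw [h3, spinRep_circleLift hk, he i, h2] at h1
  exact mul_left_cancel₀ (zpow_ne_zero _ u.coe_ne_zero) h1

theorem SphereLift.isUnitary (j : SphereLift S) {e : SumIndex (n - d) ≃ Finset (Fin (n - d))}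
    {F : ∀ x : CP d, S.SpinorFibre x ≃ₗ[ℂ] TautSum d (n - d) x}
    (hF : j.IsComponentMap e F) : IsUnitary S F := by
  rintro x φ ψ p ⟨z, hz⟩
  obtain ⟨z, rfl⟩ := z.exists_eq_frame
  obtain ⟨g, hg, -⟩ := S.simply_transitive (j.lift z) p ((j.base_lift z).trans (hz.trans p.2.symm))
  simp only [hF x _ _ z hz]
  rw [← inner_spinRep g, ← φ.2 ⟨j.lift z, (j.base_lift z).trans hz⟩ p g hg,
    ← ψ.2 ⟨j.lift z, (j.base_lift z).trans hz⟩ p g hg, PiLp.inner_apply]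
  exact (e.sum_comp fun T => inner ℂ (φ.1 _ T) (ψ.1 _ T)).symm

end Isomorphism

/-! ### Horizontal curves of the unit sphere -/

section HorizontalSphere

variable {d : ℕ}

theorem eq_of_hasDerivAt_zero {E : Type*} [NormedAddCommGroup E] [NormedSpace ℝ E] {f : ℝ → E}
    {t₀ ε : ℝ} (hε : 0 < ε) (hf : ∀ t ∈ Metric.ball t₀ ε, HasDerivAt f 0 t) :
    ∀ t ∈ Metric.ball t₀ ε, f t = f t₀ := fun _ ht =>
  Metric.isOpen_ball.is_const_of_deriv_eq_zero (convex_ball t₀ ε).isPreconnected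
    (fun s hs => (hf s hs).differentiableAt.differentiableWithinAt) (fun s hs => (hf s hs).deriv) ht
    (Metric.mem_ball_self hε)

/-- The curve `z` of unit vectors is horizontal near `t₀` for the connection of `γ_d`. -/
def Sph.IsHorizontalAt (z : ℝ → Sph d) (t₀ : ℝ) : Prop :=
  ∀ᶠ t in nhds t₀, ∃ z' : CSp (d + 1), HasDerivAt (fun s => (z s : CSp (d + 1))) z' t ∧
    inner ℂ (z t : CSp (d + 1)) z' = 0

theorem Sph.mem_line_iff {z : Sph d} {w : CSp (d + 1)} :
    w ∈ z.line.submodule ↔ ∃ a : ℂ, a • (z : CSp (d + 1)) = w := by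
  rw [Sph.line, Projectivization.submodule_mk, Submodule.mem_span_singleton]

theorem Sph.isHorizontalAt_frame {z : ℝ → Sph d} {t₀ : ℝ} :
    TautFrame.IsHorizontalAt (fun t => (z t).frame) t₀ ↔ Sph.IsHorizontalAt z t₀ := by
  refine Filter.eventually_congr (Filter.Eventually.of_forall fun t => exists_congr fun z' =>
    and_congr_right fun _ => ⟨fun h => h _ (z t).mem_line, fun h w hw => ?_⟩)
  obtain ⟨a, rfl⟩ := Sph.mem_line_iff.1 hw
  rw [inner_smul_left, h, mul_zero]

/-- Horizontal curves with the same projection to `ℂPᵈ` differ by a constant element of the circle. -/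
theorem Sph.IsHorizontalAt.exists_smul_eq {z w : ℝ → Sph d} {t₀ : ℝ} (hz : Sph.IsHorizontalAt z t₀)
    (hw : Sph.IsHorizontalAt w t₀) (hzw : ∀ t, (w t).line = (z t).line) :
    ∃ u : Circle, ∀ᶠ t in nhds t₀, w t = u • z t := by
  choose u hu using fun t => Sph.line_eq_line_iff.1 (hzw t)
  obtain ⟨ε, hε, h⟩ := Metric.eventually_nhds_iff_ball.1 (hz.and hw)
  have hin : ∀ t, inner ℂ (z t : CSp (d + 1)) (w t : CSp (d + 1)) = (u t : ℂ) := fun t => by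
    rw [hu t, Sph.coe_smul, Circle.smul_def, inner_smul_right, inner_self_eq_norm_sq_to_K,
      (z t).norm_eq, RCLike.ofReal_one, one_pow, mul_one]
  have hder : ∀ t ∈ Metric.ball t₀ ε,
      HasDerivAt (fun t => inner ℂ (z t : CSp (d + 1)) (w t : CSp (d + 1))) 0 t := by
    intro t ht
    obtain ⟨⟨z', hz', hz0⟩, w', hw', hw0⟩ := h t ht
    have h1 : inner ℂ z' (w t : CSp (d + 1)) = 0 := by
      rw [hu t, Sph.coe_smul, Circle.smul_def, inner_smul_right, inner_eq_zero_symm.1 hz0, mul_zero]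
    have h2 : inner ℂ (z t : CSp (d + 1)) w' = 0 := by
      rw [hu t, Sph.coe_smul, Circle.smul_def, inner_smul_left] at hw0
      exact (mul_eq_zero.1 hw0).resolve_left
        ((map_ne_zero (starRingEnd ℂ)).2 (u t).coe_ne_zero)
    have h3 := hz'.inner ℂ hw'
    rwa [h1, h2, add_zero] at h3
  refine ⟨u t₀, Metric.eventually_nhds_iff_ball.2 ⟨ε, hε, fun t ht => ?_⟩⟩
  have h4 := eq_of_hasDerivAt_zero hε hder t ht
  rw [hin, hin] at h4
  rw [hu t, Circle.ext h4]

/-- The horizontal lift, near `t₀`, of a continuously differentiable curve of `ℂPᵈ`: the projection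
`y t` of a fixed vector to the lines `c t`, multiplied by a solution `b` of the linear equation
`b' = a b`, `a = -⟪y, y'⟫ / ‖y‖²`. -/
theorem Sph.exists_horizontal_lift {c : ℝ → CP d} (hc : ContDiff ℝ 1 fun t => lineProj d (c t))
    (t₀ : ℝ) : ∃ z : ℝ → Sph d, (∀ t, (z t).line = c t) ∧ Sph.IsHorizontalAt z t₀ := by
  choose ζ hζ using fun t => Sph.exists_line_eq (c t)
  obtain ⟨v, hv⟩ : ∃ v : CSp (d + 1), v = ζ t₀ := ⟨_, rfl⟩
  set y : ℝ → CSp (d + 1) := fun t => lineProj d (c t) v with hy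
  have hyc : ContDiff ℝ 1 y :=
    ((ContinuousLinearMap.apply ℂ (CSp (d + 1)) v).restrictScalars ℝ).contDiff.comp hc
  have hymem : ∀ t, y t ∈ (c t).submodule := fun t => Submodule.starProjection_apply_mem _ _
  have hy0 : y t₀ = ζ t₀ := by
    rw [hy, hv]
    exact (mem_submodule_iff _ _).1 (hζ t₀ ▸ (ζ t₀).mem_line)
  have hyd : ∀ t, HasDerivAt y (deriv y t) t := fun t =>
    (hyc.differentiable one_ne_zero t).hasDerivAt
  have hyd' : Continuous (deriv y) := hyc.continuous_deriv le_rfl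
  -- the denominator is cut off at `1/2`, where the coefficient `a` no longer matters
  let a : ℝ → ℂ := fun t => -inner ℂ (y t) (deriv y t) / ((max (‖y t‖ ^ 2) (1 / 2) : ℝ) : ℂ)
  have ha : Continuous a := by
    refine ((hyc.continuous.inner hyd').neg).div ?_ fun t => ?_
    · exact Complex.continuous_ofReal.comp ((hyc.continuous.norm.pow 2).max continuous_const)
    · rw [Complex.ofReal_ne_zero]
      exact (lt_of_lt_of_le one_half_pos (le_max_right _ _)).ne'
  let b : ℝ → ℂ := fun t => Complex.exp (∫ s in t₀..t, a s)
  have hb : ∀ t, HasDerivAt b (b t * a t) t := fun t =>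
    (ha.integral_hasStrictDerivAt t₀ t).hasDerivAt.cexp
  have hb0 : b t₀ = 1 := by simp [b]
  let x : ℝ → CSp (d + 1) := fun t => b t • y t
  have hx : ∀ t, HasDerivAt x (b t • deriv y t + (b t * a t) • y t) t := fun t => (hb t).smul (hyd t)
  have hx0 : x t₀ = ζ t₀ := by simp only [x, hb0, one_smul, hy0]
  have hev : ∀ᶠ t in nhds t₀, 1 / 2 < ‖y t‖ ^ 2 := by
    refine (hyc.continuous.norm.pow 2).continuousAt.eventually_const_lt ?_
    rw [Pi.pow_apply, hy0, (ζ t₀).norm_eq]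
    norm_num
  obtain ⟨ε, hε, h⟩ := Metric.eventually_nhds_iff_ball.1 hev
  have horth : ∀ t ∈ Metric.ball t₀ ε,
      inner ℂ (x t) (b t • deriv y t + (b t * a t) • y t) = 0 := by
    intro t ht
    have h1 := h t ht
    have h2 : ((‖y t‖ ^ 2 : ℝ) : ℂ) ≠ 0 := Complex.ofReal_ne_zero.2 (by linarith)
    have h3 : a t * ((‖y t‖ ^ 2 : ℝ) : ℂ) = -inner ℂ (y t) (deriv y t) := by
      simp only [a]
      rw [max_eq_left h1.le, div_mul_cancel₀ _ h2]
    have h4 : inner ℂ (y t) (y t) = ((‖y t‖ ^ 2 : ℝ) : ℂ) := by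
      rw [inner_self_eq_norm_sq_to_K]
      push_cast
      rfl
    simp only [x]
    rw [inner_smul_left, inner_add_right, inner_smul_right, inner_smul_right, h4]
    linear_combination (starRingEnd ℂ) (b t) * b t * h3
  have hnorm : ∀ t ∈ Metric.ball t₀ ε, ‖x t‖ = 1 := by
    have h1 : ∀ t ∈ Metric.ball t₀ ε, HasDerivAt (fun t => inner ℂ (x t) (x t)) 0 t := by
      intro t ht
      have h2 := (hx t).inner ℂ (hx t)
      rwa [horth t ht, inner_eq_zero_symm.1 (horth t ht), add_zero] at h2
    intro t ht
    have h3 := eq_of_hasDerivAt_zero hε h1 t ht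
    rw [inner_self_eq_norm_sq_to_K, inner_self_eq_norm_sq_to_K, hx0, (ζ t₀).norm_eq,
      RCLike.ofReal_one, one_pow] at h3
    have h4 : ‖x t‖ ^ 2 = 1 := Complex.ofReal_injective
      (by rw [Complex.ofReal_pow, Complex.ofReal_one]; exact h3)
    exact (pow_eq_one_iff_of_nonneg (norm_nonneg _) two_ne_zero).1 h4
  classical
  let z : ℝ → Sph d := fun t => if ht : ‖x t‖ = 1 then ⟨x t, mem_sphere_zero_iff_norm.2 ht⟩ else ζ t
  have hz : ∀ t ∈ Metric.ball t₀ ε, (z t : CSp (d + 1)) = x t := fun t ht => by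
    simp only [z, dif_pos (hnorm t ht)]
  refine ⟨z, fun t => ?_, Metric.eventually_nhds_iff_ball.2 ⟨ε, hε, fun t ht =>
    ⟨b t • deriv y t + (b t * a t) • y t, ?_, ?_⟩⟩⟩
  · by_cases ht : ‖x t‖ = 1
    · simp only [z, dif_pos ht]
      exact Sph.line_eq _ (Submodule.smul_mem _ _ (hymem t))
    · simp only [z, dif_neg ht, hζ]
  · exact (hx t).congr_of_eventuallyEq
      (Filter.eventually_of_mem (Metric.isOpen_ball.mem_nhds ht) hz)
  · rw [hz t ht]
    exact horth t ht

end HorizontalSphere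

/-! ### Horizontal curves of the spin structure and parallelism -/

/-- The metric of the ambient space as a continuous bilinear form. -/
def metricCLM (n : ℕ) : Op n →L[ℝ] Op n →L[ℝ] ℝ :=
  LinearMap.toContinuousBilinearMap (LinearMap.mk₂ ℝ (metric n)
    (fun X Y Z => by rw [metric_comm, metric_add_right, metric_comm Z X, metric_comm Z Y])
    (fun a X Y => by rw [metric_comm, metric_smul_right, metric_comm Y X, smul_eq_mul])
    metric_add_right (fun a X Y => by rw [metric_smul_right, smul_eq_mul]))

section Horizontal

variable {d n : ℕ} {hdn : d < n} {S : SpinStructure.{u} hdn}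

theorem hasDerivAt_clm_apply {E F : Type*} [NormedAddCommGroup E] [NormedSpace ℝ E]
    [NormedAddCommGroup F] [NormedSpace ℝ F] (L : E →L[ℝ] F) {z : ℝ → E} {z' : E} {t : ℝ}
    (h : HasDerivAt z z' t) : HasDerivAt (fun s => L (z s)) (L z') t :=
  L.hasFDerivAt.comp_hasDerivAt t h

set_option maxHeartbeats 1600000 in
theorem hasDerivAt_normalFrame {z : ℝ → CSp (d + 1)} {z' : CSp (d + 1)} {t : ℝ}
    (h : HasDerivAt z z' t) : HasDerivAt (fun s => normalFrame d n (z s)) (normalFrame d n z') t :=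
  hasDerivAt_clm_apply (F := CSp (n - d) →L[ℝ] Op n) (normalFrame d n) h

/-- The normal frames of a horizontal curve of unit vectors of `γ_d` are parallel. -/
theorem SphereLift.isHorizontalAt (j : SphereLift S) {z : ℝ → Sph d} {t₀ : ℝ}
    (hz : Sph.IsHorizontalAt z t₀) : S.IsHorizontalAt (fun t => j.lift (z t)) t₀ := by
  filter_upwards [hz] with t ⟨z', hz', hz0⟩
  have hzc : ContinuousAt z t := Topology.IsInducing.subtypeVal.continuousAt_iff.2 hz'.continuousAt
  have hf : (fun s => (S.toFrame (j.lift (z s))).1.2) = fun s => normalFrame d n (z s : CSp (d + 1)) :=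
    funext fun s => ContinuousLinearMap.ext fun v => by
      rw [j.toFrame_lift, rotFrame_apply, rot_one]
  refine ⟨j.continuous_lift.continuousAt.comp hzc, normalFrame d n z', ?_, fun v Y hY => ?_⟩
  · rw [hf]
    exact hasDerivAt_normalFrame hz'
  · rw [j.base_lift] at hY
    obtain ⟨w, rfl⟩ := (mem_normalSpace_iff hdn (z t).mem_line (z t).norm_eq Y).1 hY
    rw [metric_normalFrame hdn, inner_eq_zero_symm.1 hz0, zero_mul, Complex.zero_re]

/-- Horizontal curves of the spin structure over the same curve differ by a constant element of the
spin group: the inner products of their frames are constant, so that the curves of frames differ by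
a constant rotation, and the claim follows by the uniqueness of lifts to the covering. -/
theorem SphereLift.exists_act_eq (j : SphereLift S) {z : ℝ → Sph d} {p : ℝ → S.P} {t₀ : ℝ}
    (hz : Sph.IsHorizontalAt z t₀) (hp : S.IsHorizontalAt p t₀)
    (hzp : ∀ t, S.base (p t) = (z t).line) :
    ∃ g, ∀ᶠ t in nhds t₀, p t = S.act (j.lift (z t)) g := by
  choose γ hγ using fun t =>
    (S.simply_transitive (j.lift (z t)) (p t) ((j.base_lift (z t)).trans (hzp t).symm)).exists
  obtain ⟨ε, hε, h⟩ := Metric.eventually_nhds_iff_ball.1 ((j.isHorizontalAt hz).and hp)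
  have hframe : ∀ t v, (S.toFrame (p t)).1.2 v = normalFrame d n (z t : CSp (d + 1)) (rot (γ t) v) :=
    fun t v => by rw [hγ t, S.toFrame_act, j.toFrame_lift, rotFrame_apply, rot_one]
  have hlift : ∀ t v, (S.toFrame (j.lift (z t))).1.2 v = normalFrame d n (z t : CSp (d + 1)) v :=
    fun t v => by rw [j.toFrame_lift, rotFrame_apply, rot_one]
  have hnormal : ∀ t v, normalFrame d n (z t : CSp (d + 1)) v ∈ normalSpace hdn (z t).line := fun t v =>
    (mem_normalSpace_iff hdn (z t).mem_line (z t).norm_eq _).2 ⟨v, rfl⟩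
  have hrot : ∀ t ∈ Metric.ball t₀ ε, ∀ v, rot (γ t) v = rot (γ t₀) v := by
    intro t ht v
    refine ext_inner_right ℝ fun w => ?_
    have hin : ∀ s, metricCLM n ((S.toFrame (p s)).1.2 v) ((S.toFrame (j.lift (z s))).1.2 w) =
        inner ℝ (rot (γ s) v) w := fun s => by
      change metric n _ _ = _
      rw [hframe, hlift, metric_normalFrame_unit hdn (z s).norm_eq, inner_real_eq]
    rw [← hin, ← hin]
    refine eq_of_hasDerivAt_zero hε (f := fun s =>
      metricCLM n ((S.toFrame (p s)).1.2 v) ((S.toFrame (j.lift (z s))).1.2 w)) (fun s hs => ?_) t ht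
    obtain ⟨⟨-, F', hF', hF0⟩, -, f', hf', hf0⟩ := h s hs
    have h1 := (metricCLM n).hasDerivAt_of_bilinear
      (fun _ => hf'.clm_apply (hasDerivAt_const s v)) (fun _ => hF'.clm_apply (hasDerivAt_const s w))
    have h2 : metric n ((S.toFrame (p s)).1.2 v) (F' w) = 0 := by
      rw [metric_comm, hframe]
      exact hF0 w _ (by rw [j.base_lift]; exact hnormal s _)
    have h3 : metric n (f' v) ((S.toFrame (j.lift (z s))).1.2 w) = 0 := by
      rw [hlift]
      exact hf0 v _ (by rw [hzp]; exact hnormal s _)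
    simp only [map_zero, add_zero] at h1
    have h4 : metricCLM n ((S.toFrame (p s)).1.2 v) (F' w) +
        metricCLM n (f' v) ((S.toFrame (j.lift (z s))).1.2 w) = 0 := by
      change metric n _ _ + metric n _ _ = 0
      rw [h2, h3, add_zero]
    rwa [h4] at h1
  refine ⟨γ t₀, Metric.eventually_nhds_iff_ball.2 ⟨ε, hε, ?_⟩⟩
  refine S.covering.eqOn_of_comp_eqOn (convex_ball t₀ ε).isPreconnected
    (fun t ht => (h t ht).2.1.continuousWithinAt)
    (fun t ht => ((S.continuous_act.comp (Continuous.prodMk_left (γ t₀))).continuousAt.comp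
      (h t ht).1.1).continuousWithinAt) (fun t ht => ?_) (Metric.mem_ball_self hε) (hγ t₀)
  refine SOFrame.ext_iff'.2 ⟨?_, fun v => ?_⟩
  · change S.base (p t) = (S.toFrame (S.act _ _)).1.1
    rw [S.base_act, hzp]
    exact (j.base_lift (z t)).symm
  · change (S.toFrame (p t)).1.2 v = (S.toFrame (S.act (j.lift (z t)) (γ t₀))).1.2 v
    rw [hframe, hrot t ht, S.toFrame_act, hlift]

theorem hasDerivAt_spinor_iff {k : ℕ} {f : ℝ → Spinor k} {f' : Spinor k} {t : ℝ} :
    HasDerivAt f f' t ↔ ∀ T, HasDerivAt (fun s => f s T) (f' T) t := by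
  constructor
  · intro h T
    exact ((EuclideanSpace.proj T : Spinor k →L[ℂ] ℂ).restrictScalars ℝ).hasFDerivAt.comp_hasDerivAt t h
  · intro h
    have h1 := hasDerivAt_pi.2 h
    exact ((PiLp.continuousLinearEquiv 2 ℝ fun _ : Finset (Fin k) => ℂ).symm :
      (Finset (Fin k) → ℂ) →L[ℝ] Spinor k).hasFDerivAt.comp_hasDerivAt t h1

theorem SphereLift.isParallel (j : SphereLift S) {e : SumIndex (n - d) ≃ Finset (Fin (n - d))}
    {F : ∀ x : CP d, S.SpinorFibre x ≃ₗ[ℂ] TautSum d (n - d) x} (hF : j.IsComponentMap e F) :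
    IsParallel S F := by
  intro c hc ψ t₀ φ
  obtain ⟨z, hzc, hz⟩ := Sph.exists_horizontal_lift hc t₀
  constructor
  · rintro ⟨p, hp, hψ⟩ i
    obtain ⟨g, hg⟩ := j.exists_act_eq hz hp fun t => (p t).2.trans (hzc t).symm
    refine ⟨fun t => ⟨(z t).frame, hzc t⟩, Sph.isHorizontalAt_frame.2 hz, ?_⟩
    have hψg : ∀ t (χ : S.SpinorFibre (c t)), (p t : S.P) = S.act (j.lift (z t)) g →
        (F (c t) χ i).1 ⟨(z t).frame, hzc t⟩ = spinRep (n - d) g (χ.1 (p t)) (e i) := fun t χ h => by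
      refine (hF _ χ i _ (hzc t)).trans ?_
      rw [χ.2 ⟨j.lift (z t), (j.base_lift (z t)).trans (hzc t)⟩ (p t) g h]
    have h1 := ((LinearMap.toContinuousLinearMap (spinRep (n - d) g)).restrictScalars
      ℝ).hasFDerivAt.comp_hasDerivAt t₀ hψ
    have h2 := hasDerivAt_spinor_iff.1 h1 (e i)
    exact (h2.congr_of_eventuallyEq (hg.mono fun t ht => hψg t (ψ t) ht)).congr_deriv
      (hψg t₀ φ hg.self_of_nhds).symm
  · intro h
    refine ⟨fun t => ⟨j.lift (z t), (j.base_lift (z t)).trans (hzc t)⟩, j.isHorizontalAt hz, ?_⟩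
    rw [hasDerivAt_spinor_iff]
    intro T
    obtain ⟨i, rfl⟩ := e.surjective T
    obtain ⟨p, hp, hψ⟩ := h i
    choose w hw using fun t => (p t).1.exists_eq_frame
    have hwh : Sph.IsHorizontalAt w t₀ := by
      rw [← Sph.isHorizontalAt_frame]
      simpa only [hw] using hp
    have hwc : ∀ t, (w t).line = c t := fun t => by
      rw [← Sph.base_frame, ← hw t, (p t).2]
    obtain ⟨u, hu⟩ := hz.exists_smul_eq hwh fun t => (hwc t).trans (hzc t).symm
    have hψu : ∀ t (χ : S.SpinorFibre (c t)), w t = u • z t →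
        χ.1 ⟨j.lift (z t), (j.base_lift (z t)).trans (hzc t)⟩ (e i) =
          (u : ℂ) ^ exponent i * (F (c t) χ i).1 (p t) := fun t χ h => by
      refine (hF _ χ i _ (hzc t)).symm.trans ?_
      exact (F (c t) χ i).2 ⟨(z t).frame, hzc t⟩ (p t) u (by rw [hw, h, Sph.frame_act])
    exact ((hψ.const_mul _).congr_of_eventuallyEq (hu.mono fun t ht => hψu t (ψ t) ht)).congr_deriv
      (hψu t₀ φ hu.self_of_nhds).symm

end Horizontal

end SpinNormal

end

theorem corollary4p4 (d n : ℕ) (hdn : d < n) (hd : Odd d) (hn : Odd n) :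
    Nonempty (SpinNormal.SpinStructure.{0} hdn) ∧
      ∀ S : SpinNormal.SpinStructure.{u} hdn,
        ∃ F : ∀ x : SpinNormal.CP d, S.SpinorFibre x ≃ₗ[ℂ] SpinNormal.TautSum d (n - d) x,
          SpinNormal.IsUnitary S F ∧ SpinNormal.IsParallel S F := by
  have hk : Even (n - d) := Nat.Odd.sub_odd hn hd
  have : Fact (Even (n - d)) := ⟨hk⟩
  refine ⟨⟨SpinNormal.stdSpinStructure hdn⟩, fun S => ?_⟩
  obtain ⟨j⟩ := S.nonempty_sphereLift hd.pos
  obtain ⟨e, he⟩ := SpinNormal.exists_sumIndex_equiv (n - d)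
  obtain ⟨F, hF⟩ := j.exists_iso hk he
  exact ⟨F, j.isUnitary hF, j.isParallel hF⟩
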